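/- Let $N\ge 2$, $n=n_1+\dots+n_N$, and let $f:\mathbb R^n\to\mathbb R^n$ be a $\mathcal C^1$ vector field with Jacobian $J(x)=\partial f/\partial x(x)$. Partition $x=[x_1^T,\dots,x_N^T]^T$ with $x_i\in\mathbb R^{n_i}$, and every $A\in\mathbb R^{n\times n}$ accordingly into blocks $A_{ij}\in\mathbb R^{n_i\times n_j}$. Let $D\subseteq\mathbb R^n$ (for instance $D=\mathbb R^n$ or a forward invariant set) be such that $\mathcal J=\{J(x):x\in D\}$ is bounded. **Notation.** $A^{[2]}$ is the second additive compound of $A$, indexed by pairs $a<b$ in lexicographic order. $\mathrm{vec}(X)$ is the row vectorisation of a matrix $X$, and $\vec X$ the strict upper row half-vectorisation of a skew-symmetric $X$. The matrices $L_m,M_m,Q_{m,l}$ are given by: $L_m\mathrm{vec}(X)$ lists the strictly upper triangular entries of an $m\times m$ matrix $X$; $\mathrm{vec}(X)=M_m\vec X$ for skew-symmetric $X\in\mathbb R^{m\times m}$; and $\mathrm{vec}(X^T)=Q_{m,l}\mathrm{vec}(X)$ for $X\in\mathbb R^{m\times l}$. Further $A_{ii}\oplus A_{jj}=A_{ii}\otimes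 I_{n_j}+I_{n_i}\otimes A_{jj}$. For $k\ne i$ let $$B_{ik}=\begin{cases}L_{n_i}\big[(A_{ik}\otimes I_{n_i})-(I_{n_i}\otimes A_{ik})Q_{n_k,n_i}\big], & k<i,\\ L_{n_i}\big[(I_{n_i}\otimes A_{ik})-(A_{ik}\otimes I_{n_i})Q_{n_i,n_k}\big], & k>i,\end{cases}$$ and for $i<j$ and $k\notin\{i,j\}$ let $$G^1_{ij}=(I_{n_i}\otimes A_{ji})M_{n_i},\qquad G^2_{ij}=(A_{ij}\otimes I_{n_j})M_{n_j},$$ $$H^{ij}_{kj}=\begin{cases}A_{ik}\otimes I_{n_j}, & k<j,\\ -(A_{ik}\otimes I_{n_j})Q_{n_j,n_k}, & k>j,\end{cases}\qquad H^{ij}_{ki}=\begin{cases}I_{n_i}\otimes A_{jk}, & k>i,\\ -(I_{n_i}\otimes A_{jk})Q_{n_k,n_i}, & k<i.\end{cases}$$ **Gains.** For a set $\Omega$ of pairs of matrices, $\gamma$ is an upper bound to the $L_2$ gain of $\dot\delta=S(t)\delta+T(t)u$, $[S(t),T(t)]\in\Omega$, if there is $M>0$ such that $$\int_0^\infty|\delta(t)|^2dt\le\gamma^2\int_0^\infty|u(t)|^2dt+M|\delta(0)|^2$$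 for all continuous $S(\cdot),T(\cdot)$ with $[S(t),T(t)]\in\Omega$ for all $t\ge0$, all measurable $u$ and all solutions $\delta$. Suppose that the following real numbers are upper bounds to the $L_2$ gains of the corresponding systems, the set $\Omega$ being in each case the set of values of the pair of coefficient matrices when $A$ ranges over $\mathcal J$: * $\gamma^{ij}_{kj}$ for $\dot\delta=(A_{ii}\oplus A_{jj})\delta+H^{ij}_{kj}u$ and $\gamma^{ij}_{ki}$ for $\dot\delta=(A_{ii}\oplus A_{jj})\delta+H^{ij}_{ki}u$ ($i<j$, $k\notin\{i,j\}$); * $\delta^i_k$ for $\dot\delta=A_{ii}^{[2]}\delta+B_{ik}u$ ($k\ne i$); * $\eta^q_{ij}$ for $\dot\delta=(A_{ii}\oplus A_{jj})\delta+G^q_{ij}u$ ($i<j$, $q=1,2$). **Gain matrices.** Let $R_{ij}$ ($i<j$) be the number of matrices among $H^{ij}_{kj}$, $H^{ij}_{ki}$ ($k\notin\{i,j\}$), $G^1_{ij}$, $G^2_{ij}$ that do not vanish identically for $A\in\mathcal J$, and $R_i$ the number of $k\neq i$ such that $B_{ik}$ does not vanish identically for $A\in\mathcal J$. Define $\Gamma\in\mathbb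 R^{\binom N2\times\binom N2}$, $\Delta\in\mathbb R^{N\times\binom N2}$, $\Upsilon\in\mathbb R^{\binom N2\times N}$, with pairs $i<j$ and $l<m$ as indices, by * $\Gamma_{ij,lm}=0$ if $(i,j)=(l,m)$ or $\{i,j\}\cap\{l,m\}=\emptyset$; otherwise, with $k$ the element of $\{l,m\}$ not in $\{i,j\}$, $\Gamma_{ij,lm}=R_{ij}(\gamma^{ij}_{ki})^2$ if $i\in\{l,m\}$ and $\Gamma_{ij,lm}=R_{ij}(\gamma^{ij}_{kj})^2$ if $j\in\{l,m\}$; * $\Delta_{i,lm}=R_i(\delta^i_m)^2$ if $l=i$, $R_i(\delta^i_l)^2$ if $m=i$, and $0$ otherwise; * $\Upsilon_{ij,k}=R_{ij}(\eta^1_{ij})^2$ if $k=i$, $R_{ij}(\eta^2_{ij})^2$ if $k=j$, and $0$ otherwise. **Claim.** If the spectral radius satisfies $\rho(\Upsilon\Delta+\Gamma)<1$, then the second additive compound equation $\dot\delta^{(2)}(t)=J(x(t))^{[2]}\delta^{(2)}(t)$ is exponentially contracting along the trajectories in $D$, i.e. the system is $2$-contracting on $D$: there are constants $K,c>0$ such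 that for every solution $x:[0,\infty)\to D$ of $\dot x=f(x)$, every solution $\delta^{(2)}$ of this equation on $[0,\infty)$ and all $0\le s\le t$, $$|\delta^{(2)}(t)|\le K e^{-c(t-s)}|\delta^{(2)}(s)|.$$ -/

import Mathlib

open MeasureTheory Set
open scoped Kronecker Matrix

noncomputable section

namespace SmallGain

/-! ### Linear algebra -/

/-- Pairs `(a, b)` with `a < b`, the index set of `ℝ^(n choose 2)`. -/
abbrev OrdPair (ι : Type*) [LT ι] := {p : ι × ι // p.1 < p.2}

/-- The second additive compound `A^[2]`: its entry at `((a,b),(c,d))` is the derivative at `ε = 0`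
of the minor of `1 + ε A` with rows `a < b` and columns `c < d`. Equivalently, for skew-symmetric
`X`, the strictly upper triangular entries of `A X + X Aᵀ` are `A^[2]` applied to those of `X`. -/
def addCompound2 {ι : Type*} [LinearOrder ι] (A : Matrix ι ι ℝ) :
    Matrix (OrdPair ι) (OrdPair ι) ℝ :=
  Matrix.of fun p q =>
    (if p.1.2 = q.1.2 then A p.1.1 q.1.1 else 0) + (if p.1.1 = q.1.1 then A p.1.2 q.1.2 else 0)
      - (if p.1.2 = q.1.1 then A p.1.1 q.1.2 else 0)
      - (if p.1.1 = q.1.2 then A p.1.2 q.1.1 else 0)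

/-- `L_m`, extracting the strict upper half-vectorisation from the row vectorisation
`vec X = (X a b)_(a,b)` of an `m × m` matrix `X`. -/
def matL (m : ℕ) : Matrix (OrdPair (Fin m)) (Fin m × Fin m) ℝ :=
  Matrix.of fun p ab => if ab = p.1 then 1 else 0

/-- `M_m`, recovering the row vectorisation of a skew-symmetric `m × m` matrix from its strict
upper half-vectorisation. -/
def matM (m : ℕ) : Matrix (Fin m × Fin m) (OrdPair (Fin m)) ℝ :=
  Matrix.of fun ab p => if ab = p.1 then 1 else if ab.swap = p.1 then -1 else 0

/-- `Q_{m,l}`, characterised by `vec (Xᵀ) = Q_{m,l} vec X` for `X` of size `m × l`. -/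
def matQ (m l : ℕ) : Matrix (Fin l × Fin m) (Fin m × Fin l) ℝ :=
  Matrix.of fun ba cd => if ba.swap = cd then 1 else 0

/-- The coordinates of `x = (x_1, …, x_N)` with `x_i ∈ ℝ^(n i)`, in lexicographic order. -/
abbrev Idx {N : ℕ} (n : Fin N → ℕ) := Σₗ i : Fin N, Fin (n i)

/-- Matrices acting on the whole state. -/
abbrev BigMat {N : ℕ} (n : Fin N → ℕ) := Matrix (Idx n) (Idx n) ℝ

/-- The block `A_ij`. -/
def block {N : ℕ} {n : Fin N → ℕ} (i j : Fin N) (A : BigMat n) :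
    Matrix (Fin (n i)) (Fin (n j)) ℝ :=
  Matrix.of fun a b => A (toLex ⟨i, a⟩) (toLex ⟨j, b⟩)

/-- `A_ii ^ [2]`. -/
def diagDyn {N : ℕ} {n : Fin N → ℕ} (i : Fin N) (A : BigMat n) :
    Matrix (OrdPair (Fin (n i))) (OrdPair (Fin (n i))) ℝ :=
  addCompound2 (block i i A)

/-- The Kronecker sum `A_ii ⊕ A_jj`. -/
def offDyn {N : ℕ} {n : Fin N → ℕ} (i j : Fin N) (A : BigMat n) :
    Matrix (Fin (n i) × Fin (n j)) (Fin (n i) × Fin (n j)) ℝ :=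
  block i i A ⊗ₖ (1 : Matrix (Fin (n j)) (Fin (n j)) ℝ) +
    (1 : Matrix (Fin (n i)) (Fin (n i)) ℝ) ⊗ₖ block j j A

/-- `B_ik` for `k < i`; its input is `vec X_ki`. -/
def matBlt {N : ℕ} {n : Fin N → ℕ} (i k : Fin N) (A : BigMat n) :
    Matrix (OrdPair (Fin (n i))) (Fin (n k) × Fin (n i)) ℝ :=
  matL (n i) * (block i k A ⊗ₖ (1 : Matrix (Fin (n i)) (Fin (n i)) ℝ) -
    ((1 : Matrix (Fin (n i)) (Fin (n i)) ℝ) ⊗ₖ block i k A) * matQ (n k) (n i))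

/-- `B_ik` for `k > i`; its input is `vec X_ik`. -/
def matBgt {N : ℕ} {n : Fin N → ℕ} (i k : Fin N) (A : BigMat n) :
    Matrix (OrdPair (Fin (n i))) (Fin (n i) × Fin (n k)) ℝ :=
  matL (n i) * ((1 : Matrix (Fin (n i)) (Fin (n i)) ℝ) ⊗ₖ block i k A -
    (block i k A ⊗ₖ (1 : Matrix (Fin (n i)) (Fin (n i)) ℝ)) * matQ (n i) (n k))

/-- `G¹_ij`. -/
def matG1 {N : ℕ} {n : Fin N → ℕ} (i j : Fin N) (A : BigMat n) :
    Matrix (Fin (n i) × Fin (n j)) (OrdPair (Fin (n i))) ℝ :=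
  ((1 : Matrix (Fin (n i)) (Fin (n i)) ℝ) ⊗ₖ block j i A) * matM (n i)

/-- `G²_ij`. -/
def matG2 {N : ℕ} {n : Fin N → ℕ} (i j : Fin N) (A : BigMat n) :
    Matrix (Fin (n i) × Fin (n j)) (OrdPair (Fin (n j))) ℝ :=
  (block i j A ⊗ₖ (1 : Matrix (Fin (n j)) (Fin (n j)) ℝ)) * matM (n j)

/-- `H^{ij}_{kj}` for `k < j`; its input is `vec X_kj`. -/
def matHjlt {N : ℕ} {n : Fin N → ℕ} (i j k : Fin N) (A : BigMat n) :
    Matrix (Fin (n i) × Fin (n j)) (Fin (n k) × Fin (n j)) ℝ :=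
  block i k A ⊗ₖ (1 : Matrix (Fin (n j)) (Fin (n j)) ℝ)

/-- `H^{ij}_{kj}` for `k > j`; its input is `vec X_jk`. -/
def matHjgt {N : ℕ} {n : Fin N → ℕ} (i j k : Fin N) (A : BigMat n) :
    Matrix (Fin (n i) × Fin (n j)) (Fin (n j) × Fin (n k)) ℝ :=
  -((block i k A ⊗ₖ (1 : Matrix (Fin (n j)) (Fin (n j)) ℝ)) * matQ (n j) (n k))

/-- `H^{ij}_{ki}` for `k > i`; its input is `vec X_ik`. -/
def matHigt {N : ℕ} {n : Fin N → ℕ} (i j k : Fin N) (A : BigMat n) :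
    Matrix (Fin (n i) × Fin (n j)) (Fin (n i) × Fin (n k)) ℝ :=
  (1 : Matrix (Fin (n i)) (Fin (n i)) ℝ) ⊗ₖ block j k A

/-- `H^{ij}_{ki}` for `k < i`; its input is `vec X_ki`. -/
def matHilt {N : ℕ} {n : Fin N → ℕ} (i j k : Fin N) (A : BigMat n) :
    Matrix (Fin (n i) × Fin (n j)) (Fin (n k) × Fin (n i)) ℝ :=
  -(((1 : Matrix (Fin (n i)) (Fin (n i)) ℝ) ⊗ₖ block j k A) * matQ (n k) (n i))

/-! ### `L₂` gains -/

/-- `δ` is a (Carathéodory) solution on `[0, ∞)` of `δ' = A(t) δ + B(t) u(t)`: it is the integral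
of the right-hand side, which is integrable on every `[0, t]`. -/
def IsLinSolution {ι κ : Type*} [Fintype ι] [Fintype κ]
    (A : ℝ → Matrix ι ι ℝ) (B : ℝ → Matrix ι κ ℝ)
    (u : ℝ → EuclideanSpace ℝ κ) (δ : ℝ → EuclideanSpace ℝ ι) : Prop :=
  ∀ t : ℝ, 0 ≤ t →
    IntervalIntegrable
      (fun s => (WithLp.toLp 2 (A s *ᵥ (δ s).ofLp + B s *ᵥ (u s).ofLp) : EuclideanSpace ℝ ι))
      volume 0 t ∧
    δ t = δ 0 + ∫ s in (0 : ℝ)..t,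
      (WithLp.toLp 2 (A s *ᵥ (δ s).ofLp + B s *ᵥ (u s).ofLp) : EuclideanSpace ℝ ι)

/-- `γ` is an upper bound to the `L₂` gain of `δ' = A(t) δ + B(t) u`, `[A(t), B(t)] ∈ Ω`, with `A`
and `B` continuous. The constant `M` is uniform over all these systems, inputs and solutions. -/
def IsL2GainBound {ι κ : Type*} [Fintype ι] [Fintype κ]
    (Ω : Set (Matrix ι ι ℝ × Matrix ι κ ℝ)) (γ : ℝ) : Prop :=
  ∃ M : ℝ, 0 < M ∧
    ∀ (A : ℝ → Matrix ι ι ℝ) (B : ℝ → Matrix ι κ ℝ),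
      ContinuousOn A (Ici 0) → ContinuousOn B (Ici 0) → (∀ t, 0 ≤ t → (A t, B t) ∈ Ω) →
      ∀ u : ℝ → EuclideanSpace ℝ κ, Measurable u →
      ∀ δ : ℝ → EuclideanSpace ℝ ι, IsLinSolution A B u δ →
        ∫⁻ t in Ici (0 : ℝ), ‖δ t‖ₑ ^ 2 ≤
          ENNReal.ofReal (γ ^ 2) * (∫⁻ t in Ici (0 : ℝ), ‖u t‖ₑ ^ 2) +
            ENNReal.ofReal M * ‖δ 0‖ₑ ^ 2

/-- The set of values `[S(A), T(A)]` of the coefficients of a subsystem `δ' = S(A) δ + T(A) u`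
when the full matrix `A` ranges over `𝒥`. -/
def coeffSet {N : ℕ} {n : Fin N → ℕ} {ι κ : Type*} (𝒥 : Set (BigMat n))
    (S : BigMat n → Matrix ι ι ℝ) (T : BigMat n → Matrix ι κ ℝ) :
    Set (Matrix ι ι ℝ × Matrix ι κ ℝ) :=
  (fun A => (S A, T A)) '' 𝒥

/-- A family of numbers, one for every single-channel subsystem. -/
structure Gains (N : ℕ) where
  /-- `γj i j k` is `γ^{ij}_{kj}`, for `i < j` and `k ∉ {i, j}` -/
  γj : Fin N → Fin N → Fin N → ℝ
  /-- `γi i j k` is `γ^{ij}_{ki}`, for `i < j` and `k ∉ {i, j}` -/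
  γi : Fin N → Fin N → Fin N → ℝ
  /-- `δ i k` is `δ^i_k`, for `k ≠ i` -/
  δ : Fin N → Fin N → ℝ
  /-- `η1 i j` is `η¹_ij`, for `i < j` -/
  η1 : Fin N → Fin N → ℝ
  /-- `η2 i j` is `η²_ij`, for `i < j` -/
  η2 : Fin N → Fin N → ℝ

/-- The numbers are upper bounds to the `L₂` gains of the single-channel subsystems, for
coefficients given by matrices in `𝒥`. -/
structure Gains.AreBounds {N : ℕ} {n : Fin N → ℕ} (g : Gains N) (𝒥 : Set (BigMat n)) : Prop where
  hγj_lt : ∀ i j k : Fin N, i < j → k ≠ i → k < j →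
    IsL2GainBound (coeffSet 𝒥 (offDyn i j) (matHjlt i j k)) (g.γj i j k)
  hγj_gt : ∀ i j k : Fin N, i < j → k > j →
    IsL2GainBound (coeffSet 𝒥 (offDyn i j) (matHjgt i j k)) (g.γj i j k)
  hγi_gt : ∀ i j k : Fin N, i < j → k ≠ j → k > i →
    IsL2GainBound (coeffSet 𝒥 (offDyn i j) (matHigt i j k)) (g.γi i j k)
  hγi_lt : ∀ i j k : Fin N, i < j → k < i →
    IsL2GainBound (coeffSet 𝒥 (offDyn i j) (matHilt i j k)) (g.γi i j k)
  hδ_lt : ∀ i k : Fin N, k < i →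
    IsL2GainBound (coeffSet 𝒥 (diagDyn i) (matBlt i k)) (g.δ i k)
  hδ_gt : ∀ i k : Fin N, k > i →
    IsL2GainBound (coeffSet 𝒥 (diagDyn i) (matBgt i k)) (g.δ i k)
  hη1 : ∀ i j : Fin N, i < j →
    IsL2GainBound (coeffSet 𝒥 (offDyn i j) (matG1 i j)) (g.η1 i j)
  hη2 : ∀ i j : Fin N, i < j →
    IsL2GainBound (coeffSet 𝒥 (offDyn i j) (matG2 i j)) (g.η2 i j)

/-! ### The gain matrices -/

/-- The input matrix `T(A)` does not vanish identically for `A ∈ 𝒥`. -/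
def Active {N : ℕ} {n : Fin N → ℕ} {ι κ : Type*} (𝒥 : Set (BigMat n))
    (T : BigMat n → Matrix ι κ ℝ) : Prop :=
  ∃ A ∈ 𝒥, T A ≠ 0

/-- `R_ij`, the number of nonzero matrices among `H^{ij}_{kj}`, `H^{ij}_{ki}` (`k ∉ {i, j}`),
`G¹_ij` and `G²_ij`. -/
def Rij {N : ℕ} {n : Fin N → ℕ} (𝒥 : Set (BigMat n)) (i j : Fin N) : ℕ :=
  Set.ncard {k : Fin N | k ≠ i ∧
      (k < j ∧ Active 𝒥 (matHjlt i j k) ∨ k > j ∧ Active 𝒥 (matHjgt i j k))} +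
  Set.ncard {k : Fin N | k ≠ j ∧
      (k > i ∧ Active 𝒥 (matHigt i j k) ∨ k < i ∧ Active 𝒥 (matHilt i j k))} +
  Set.ncard {q : Fin 2 | q = 0 ∧ Active 𝒥 (matG1 i j) ∨ q = 1 ∧ Active 𝒥 (matG2 i j)}

/-- `R_i`, the number of `k ≠ i` with `B_ik` nonzero. -/
def Ri {N : ℕ} {n : Fin N → ℕ} (𝒥 : Set (BigMat n)) (i : Fin N) : ℕ :=
  Set.ncard {k : Fin N |
    k < i ∧ Active 𝒥 (matBlt i k) ∨ k > i ∧ Active 𝒥 (matBgt i k)}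

/-- The matrix `Γ`; rows are indexed by `i < j`, columns by `l < m`. -/
def gainΓ {N : ℕ} {n : Fin N → ℕ} (𝒥 : Set (BigMat n)) (g : Gains N) :
    Matrix (OrdPair (Fin N)) (OrdPair (Fin N)) ℝ :=
  Matrix.of fun p q =>
    let i := p.1.1
    let j := p.1.2
    let l := q.1.1
    let m := q.1.2
    if p = q then 0
    else if l = i then (Rij 𝒥 i j : ℝ) * g.γi i j m ^ 2
    else if m = i then (Rij 𝒥 i j : ℝ) * g.γi i j l ^ 2
    else if l = j then (Rij 𝒥 i j : ℝ) * g.γj i j m ^ 2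
    else if m = j then (Rij 𝒥 i j : ℝ) * g.γj i j l ^ 2
    else 0

/-- The matrix `Δ`. -/
def gainΔ {N : ℕ} {n : Fin N → ℕ} (𝒥 : Set (BigMat n)) (g : Gains N) :
    Matrix (Fin N) (OrdPair (Fin N)) ℝ :=
  Matrix.of fun i q =>
    if q.1.1 = i then (Ri 𝒥 i : ℝ) * g.δ i q.1.2 ^ 2
    else if q.1.2 = i then (Ri 𝒥 i : ℝ) * g.δ i q.1.1 ^ 2
    else 0

/-- The matrix `Υ`. -/
def gainΥ {N : ℕ} {n : Fin N → ℕ} (𝒥 : Set (BigMat n)) (g : Gains N) :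
    Matrix (OrdPair (Fin N)) (Fin N) ℝ :=
  Matrix.of fun p k =>
    if p.1.1 = k then (Rij 𝒥 p.1.1 p.1.2 : ℝ) * g.η1 p.1.1 p.1.2 ^ 2
    else if p.1.2 = k then (Rij 𝒥 p.1.1 p.1.2 : ℝ) * g.η2 p.1.1 p.1.2 ^ 2
    else 0

/-- The spectral radius of a real square matrix, taken over its complex eigenvalues. -/
def specRad {ι : Type*} [Fintype ι] [DecidableEq ι] (A : Matrix ι ι ℝ) : ENNReal :=
  spectralRadius ℂ (A.map Complex.ofReal)

/-! ### The nonlinear system -/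

/-- The Jacobian matrix of `f` at `x`. -/
def jacobian {ι : Type*} [Fintype ι]
    (f : EuclideanSpace ℝ ι → EuclideanSpace ℝ ι) (x : EuclideanSpace ℝ ι) : Matrix ι ι ℝ :=
  Matrix.of fun a b => (fderiv ℝ f x (EuclideanSpace.basisFun ι ℝ b)) a

/-- `x` solves `x' = f(x)` on `[0, ∞)` and remains in `D`. -/
def IsTrajectoryIn {ι : Type*} [Fintype ι]
    (f : EuclideanSpace ℝ ι → EuclideanSpace ℝ ι) (D : Set (EuclideanSpace ℝ ι))
    (x : ℝ → EuclideanSpace ℝ ι) : Prop :=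
  ∀ t : ℝ, 0 ≤ t → HasDerivWithinAt x (f (x t)) (Ici 0) t ∧ x t ∈ D

/-- `2`-contraction on `D`: the second additive compound equation `y' = J(x(t))^[2] y` is
exponentially contracting, uniformly over all trajectories `x` in `D` and all initial times. -/
def IsTwoContractingOn {ι : Type*} [Fintype ι] [LinearOrder ι]
    (f : EuclideanSpace ℝ ι → EuclideanSpace ℝ ι) (D : Set (EuclideanSpace ℝ ι)) : Prop :=
  ∃ K c : ℝ, 0 < K ∧ 0 < c ∧
    ∀ x : ℝ → EuclideanSpace ℝ ι, IsTrajectoryIn f D x →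
    ∀ y : ℝ → EuclideanSpace ℝ (OrdPair ι),
      (∀ t : ℝ, 0 ≤ t → HasDerivWithinAt y
        (WithLp.toLp 2 (addCompound2 (jacobian f (x t)) *ᵥ (y t).ofLp)) (Ici 0) t) →
      ∀ s t : ℝ, 0 ≤ s → s ≤ t → ‖y t‖ ≤ K * Real.exp (-c * (t - s)) * ‖y s‖

end SmallGain

end

/-! Read `δ^(2)` as the strictly upper triangular part of a skew-symmetric `X` with `X' = A X + X
Aᵀ`, where `A(t) = J(x(t))`. In blocks, `X_ij' = A_ii X_ij + X_ij A_jjᵀ + ∑_{k≠i} A_ik X_kj +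
∑_{k≠j} X_ik A_jkᵀ`, so each stored block is driven by other blocks through the channels `H`, `G`
(for `i < j`) or `B` (for `i = j`). Two diagonal blocks never drive each other.

By linearity a block driven by `R` active channels is the sum of `R` single-channel responses, each
starting from `1/R` of the initial value. Cauchy-Schwarz then gives the factor `R` in the gain
matrices (`integral_sq_norm_le_of_channels`, `exists_multichannel_bound`). Inputs are switched off
after a time `τ`, so every energy on `[0, τ]` is finite before any stability is known.

Let `z` and `ξ` be the vectors of energies on `[0, τ]` of the off-diagonal and diagonal blocks. Then
`z ≤ Γ z + Υ ξ + b` and `ξ ≤ Δ z + b`, with `b` proportional to `|δ^(2)(0)|²`. Eliminating `ξ`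
leaves `z ≤ (ΥΔ + Γ) z + const · b`. As the matrix is nonnegative with spectral radius below one,
this bounds `z`, hence `ξ`, by a multiple of `b` that does not depend on `τ`
(`exists_bound_of_le_mulVec_pair`).

Therefore `∫_0^τ |δ^(2)|² ≤ C |δ^(2)(0)|²`, with `C` the same for all coefficients in `𝒥`, hence for
all initial times. Since `J` is bounded on `D`, a Datko-type argument turns this into uniform
exponential decay (`exists_exponential_bound`). -/

noncomputable section

namespace SmallGain

/-! ### Linear integral equations -/

section Volterra

variable {E : Type*} [NormedAddCommGroup E] [NormedSpace ℝ E]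

/-- The Volterra operator `x ↦ h + ∫ S x`, conjugated by the weight `exp (-l t)`. -/
def volterra (S : ℝ → E →L[ℝ] E) (h : ℝ → E) (l : ℝ) (z : ℝ → E) (t : ℝ) : E :=
  Real.exp (-l * max t 0) • (h (max t 0) + ∫ s in (0 : ℝ)..max t 0, Real.exp (l * s) • S s (z s))

theorem norm_integral_exp_smul_le {S : ℝ → E →L[ℝ] E} {K : ℝ} (hK : ∀ t, ‖S t‖ ≤ K) {l : ℝ}
    (hl : 0 < l) {z : ℝ → E} {C : ℝ} (hC : ∀ t, ‖z t‖ ≤ C) {t : ℝ} (ht : 0 ≤ t) :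
    ‖∫ s in (0 : ℝ)..t, Real.exp (l * s) • S s (z s)‖ ≤ Real.exp (l * t) * (K * C / l) := by
  have hK0 : 0 ≤ K := (norm_nonneg _).trans (hK 0)
  have hC0 : 0 ≤ C := (norm_nonneg _).trans (hC 0)
  have hint : ∫ s in (0 : ℝ)..t, Real.exp (l * s) * (K * C) =
      (Real.exp (l * t) - 1) * (K * C / l) := by
    have h1 : ∀ s : ℝ, HasDerivAt (fun s => Real.exp (l * s) * (K * C / l))
        (Real.exp (l * s) * (K * C)) s := by
      intro s
      have := (((hasDerivAt_id s).const_mul l).exp).mul_const (K * C / l)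
      refine this.congr_deriv ?_
      simp only [id_eq]
      field_simp
    rw [intervalIntegral.integral_eq_sub_of_hasDerivAt (fun s _ => h1 s)]
    · simp; ring
    · exact Continuous.intervalIntegrable (by fun_prop) _ _
  calc ‖∫ s in (0 : ℝ)..t, Real.exp (l * s) • S s (z s)‖
      ≤ ∫ s in (0 : ℝ)..t, Real.exp (l * s) * (K * C) := by
        refine intervalIntegral.norm_integral_le_of_norm_le ht ?_
          (Continuous.intervalIntegrable (by fun_prop) _ _)
        refine Filter.Eventually.of_forall fun s _ => ?_
        rw [norm_smul, Real.norm_eq_abs, Real.abs_exp]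
        gcongr
        exact (S s).le_of_opNorm_le_of_le (hK s) (hC s)
    _ ≤ Real.exp (l * t) * (K * C / l) := by
        rw [hint]
        have : 0 ≤ K * C / l := by positivity
        nlinarith

/-- Banach's fixed point theorem in the sup norm weighted by `exp (-l t)`, where the integral
operator has Lipschitz constant `K / l`. This yields a solution on all of `[0, ∞)` at once.
Replacing `t` by `max t 0` freezes negative times, so that the fixed point is a bounded continuous
function on `ℝ`. -/
theorem exists_volterra_solution [CompleteSpace E] {S : ℝ → E →L[ℝ] E} (hS : Continuous S) {K : ℝ}
    (hK : ∀ t, ‖S t‖ ≤ K) {h : ℝ → E} (hh : Continuous h) {H : ℝ} (hH : ∀ t, ‖h t‖ ≤ H) :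
    ∃ x : ℝ → E, Continuous x ∧ ∀ t, 0 ≤ t → x t = h t + ∫ s in (0 : ℝ)..t, S s (x s) := by
  have hK0 : 0 ≤ K := (norm_nonneg _).trans (hK 0)
  -- Any positive `l > K` makes the operator a contraction; the `+ 1` covers `K = 0`.
  set l : ℝ := 2 * K + 1 with hl_def
  have hl : 0 < l := by positivity
  have hcont : ∀ z : ℝ → E, Continuous z → Continuous (volterra S h l z) := by
    intro z hz
    have h1 : Continuous fun t : ℝ => ∫ s in (0 : ℝ)..t, Real.exp (l * s) • S s (z s) :=
      intervalIntegral.continuous_primitive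
        (fun a b => Continuous.intervalIntegrable (by fun_prop) _ _) 0
    have h2 : Continuous fun t : ℝ => max t 0 := by fun_prop
    unfold volterra
    exact (by fun_prop : Continuous fun t : ℝ => Real.exp (-l * max t 0)).smul
      ((hh.comp h2).add (h1.comp h2))
  have hbd : ∀ z : ℝ → E, ∀ C, (∀ t, ‖z t‖ ≤ C) → ∀ t, 0 ≤ t →
      Real.exp (-l * t) * ‖∫ s in (0 : ℝ)..t, Real.exp (l * s) • S s (z s)‖ ≤ K * C / l := by
    intro z C hC t ht
    calc _ ≤ Real.exp (-l * t) * (Real.exp (l * t) * (K * C / l)) := by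
          gcongr; exact norm_integral_exp_smul_le hK hl hC ht
      _ = K * C / l := by rw [← mul_assoc, ← Real.exp_add]; simp
  let F : BoundedContinuousFunction ℝ E → BoundedContinuousFunction ℝ E := fun z =>
    BoundedContinuousFunction.ofNormedAddCommGroup (volterra S h l z) (hcont z z.continuous)
      (H + K * ‖z‖ / l) (by
        intro t
        have h0 : (0 : ℝ) ≤ max t 0 := le_max_right _ _
        unfold volterra
        rw [norm_smul, Real.norm_eq_abs, Real.abs_exp]
        calc _ ≤ Real.exp (-l * max t 0) * (‖h (max t 0)‖ +
              ‖∫ s in (0 : ℝ)..max t 0, Real.exp (l * s) • S s (z s)‖) := by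
              gcongr; exact norm_add_le _ _
          _ ≤ 1 * H + K * ‖z‖ / l := by
              rw [mul_add]
              gcongr
              · rw [Real.exp_le_one_iff]; nlinarith
              · exact hH _
              · exact hbd z _ z.norm_coe_le_norm _ h0
          _ = _ := by ring)
  have hF : ∀ z t, F z t = volterra S h l z t := fun z t => rfl
  have hKl : ((K / l).toNNReal : ℝ) = K / l := Real.coe_toNNReal _ (by positivity)
  have hcontr : ContractingWith (K / l).toNNReal F := by
    refine ⟨?_, ?_⟩
    · rw [← NNReal.coe_lt_coe, hKl, NNReal.coe_one, div_lt_one hl]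
      linarith
    · refine LipschitzWith.of_dist_le_mul fun z z' => ?_
      rw [hKl, BoundedContinuousFunction.dist_le (by positivity)]
      intro t
      have h0 : (0 : ℝ) ≤ max t 0 := le_max_right _ _
      have hi : ∀ z : BoundedContinuousFunction ℝ E, IntervalIntegrable
          (fun s => Real.exp (l * s) • S s (z s)) volume 0 (max t 0) := fun z =>
        Continuous.intervalIntegrable (by have := z.continuous; fun_prop) _ _
      rw [hF, hF, dist_eq_norm]
      unfold volterra
      rw [← smul_sub, add_sub_add_left_eq_sub, ← intervalIntegral.integral_sub (hi z) (hi z'),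
        norm_smul, Real.norm_eq_abs, Real.abs_exp]
      have := hbd (fun s => z s - z' s) (dist z z')
        (fun s => by rw [← dist_eq_norm]; exact BoundedContinuousFunction.dist_coe_le_dist s) _ h0
      simp only [map_sub, smul_sub] at this
      refine this.trans (le_of_eq ?_)
      ring
  let z := hcontr.fixedPoint F
  have hz : ∀ t, z t = volterra S h l z t := fun t => by
    rw [← hF z t, show F z = z from hcontr.fixedPoint_isFixedPt]
  refine ⟨fun t => Real.exp (l * t) • z t, by have := z.continuous; fun_prop, fun t ht => ?_⟩
  simp only [map_smul]
  rw [hz t]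
  unfold volterra
  rw [max_eq_left ht, smul_smul, ← Real.exp_add]
  simp

end Volterra

/-! ### Superposition of forced responses -/

section Superposition

variable {E : Type*} [NormedAddCommGroup E] [NormedSpace ℝ E]

/-- `x` is a Carathéodory solution on `[0, ∞)` of `x' = S(t) x + w(t)`. -/
def IsForcedSolution (S : ℝ → E →L[ℝ] E) (w x : ℝ → E) : Prop :=
  ∀ t : ℝ, 0 ≤ t → IntervalIntegrable (fun s => S s (x s) + w s) volume 0 t ∧
    x t = x 0 + ∫ s in (0 : ℝ)..t, (S s (x s) + w s)

variable [CompleteSpace E]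

/-- The gain inequality speaks of solutions on the whole half-line, so the truncated system must be
solved beyond `τ`. The forcing may jump at `τ`, but its primitive is continuous and bounded, which
is all the Volterra equation needs. -/
theorem exists_isForcedSolution_indicator {S : ℝ → E →L[ℝ] E} (hS : Continuous S) {K : ℝ}
    (hK : ∀ t, ‖S t‖ ≤ K) {v : ℝ → E} (hv : Continuous v) {τ : ℝ} (x₀ : E) :
    ∃ x : ℝ → E, Continuous x ∧ x 0 = x₀ ∧ IsForcedSolution S ((Icc 0 τ).indicator v) x := by
  have hw : Integrable ((Icc 0 τ).indicator v) :=
    (integrable_indicator_iff measurableSet_Icc).2 (hv.continuousOn.integrableOn_Icc)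
  have hwi : ∀ a b, IntervalIntegrable ((Icc 0 τ).indicator v) volume a b :=
    fun a b => hw.intervalIntegrable
  have hprim : Continuous fun t : ℝ => ∫ s in (0 : ℝ)..t, (Icc 0 τ).indicator v s :=
    intervalIntegral.continuous_primitive hwi 0
  obtain ⟨x, hx, hxe⟩ := exists_volterra_solution hS hK
    (h := fun t => x₀ + ∫ s in (0 : ℝ)..t, (Icc 0 τ).indicator v s) (by fun_prop)
    (H := ‖x₀‖ + ∫ s, ‖(Icc 0 τ).indicator v s‖) (fun t => by
      refine (norm_add_le _ _).trans (add_le_add le_rfl ?_)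
      refine (intervalIntegral.norm_integral_le_integral_norm_uIoc).trans ?_
      exact setIntegral_le_integral hw.norm (Filter.Eventually.of_forall fun _ => norm_nonneg _))
  have hx0 : x 0 = x₀ := by simpa using hxe 0 le_rfl
  refine ⟨x, hx, hx0, fun t ht => ?_⟩
  have hi : IntervalIntegrable (fun s => S s (x s)) volume 0 t :=
    Continuous.intervalIntegrable (by fun_prop) _ _
  refine ⟨hi.add (hwi _ _), ?_⟩
  rw [intervalIntegral.integral_add hi (hwi _ _), hxe t ht, hx0]
  abel

theorem IsForcedSolution.eqOn_of_hasDerivWithinAt {S : ℝ → E →L[ℝ] E} (hS : Continuous S) {K : ℝ}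
    (hK : ∀ t, ‖S t‖ ≤ K) {v : ℝ → E} (hv : Continuous v) {w : ℝ → E} {τ : ℝ}
    (hvw : EqOn w v (Icc 0 τ)) {x y : ℝ → E} (hx : Continuous x) (hxs : IsForcedSolution S w x)
    (hy : ∀ t ∈ Icc 0 τ, HasDerivWithinAt y (S t (y t) + v t) (Ici 0) t) (h0 : x 0 = y 0) :
    EqOn x y (Icc 0 τ) := by
  have hc : Continuous fun s => S s (x s) + v s := by fun_prop
  -- `x` is only known through an integral equation whose forcing may jump. `X` uses the continuous
  -- `v` instead, so it is differentiable everywhere, and it equals `x` on `[0, τ]`.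
  set X : ℝ → E := fun t => x 0 + ∫ s in (0 : ℝ)..t, (S s (x s) + v s)
  have hXx : EqOn x X (Icc 0 τ) := by
    intro t ht
    rw [(hxs t ht.1).2]
    congr 1
    refine intervalIntegral.integral_congr fun s hs => ?_
    rw [uIcc_of_le ht.1] at hs
    simp only [hvw ⟨hs.1, hs.2.trans ht.2⟩]
  have hX : ∀ t, HasDerivAt X (S t (x t) + v t) t := fun t =>
    (hc.integral_hasStrictDerivAt 0 t).hasDerivAt.const_add _
  have hXX : EqOn X y (Icc 0 τ) := by
    refine ODE_solution_unique_of_mem_Icc_right (v := fun t z => S t z + v t) (K := K.toNNReal)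
      (s := fun _ => univ) (fun t _ => ?_) (fun t _ => (hX t).continuousAt.continuousWithinAt)
      (fun t ht => ?_) (fun _ _ => mem_univ _)
      (fun t ht => (hy t ht).continuousWithinAt.mono Icc_subset_Ici_self)
      (fun t ht => (hy t (Ico_subset_Icc_self ht)).mono (Ici_subset_Ici.2 ht.1))
      (fun _ _ => mem_univ _) ?_
    · refine LipschitzOnWith.of_dist_le_mul fun a _ b _ => ?_
      rw [dist_add_right, dist_eq_norm, dist_eq_norm, ← map_sub]
      exact (S t).le_of_opNorm_le ((hK t).trans (Real.le_coe_toNNReal K)) _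
    · simp only [← hXx (Ico_subset_Icc_self ht)]
      exact (hX t).hasDerivWithinAt
    · simpa [X] using h0
  exact hXx.trans hXX

/-- Superposition: `y` is the sum on `[0, τ]` of one response per channel, by uniqueness, and the
square of a sum of `s.card` terms costs a factor `s.card`. -/
theorem integral_sq_norm_le_of_channels {S : ℝ → E →L[ℝ] E} (hS : Continuous S) {K : ℝ}
    (hK : ∀ t, ‖S t‖ ≤ K) {τ : ℝ} (hτ : 0 ≤ τ) {C : Type*} {s : Finset C} (hs : s.Nonempty)
    {v : C → ℝ → E} (hv : ∀ r ∈ s, Continuous (v r)) {M G : C → ℝ} (hM : ∀ r ∈ s, 0 ≤ M r)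
    (hG : ∀ r ∈ s, 0 ≤ G r)
    (hgain : ∀ r ∈ s, ∀ x : ℝ → E, IsForcedSolution S ((Icc 0 τ).indicator (v r)) x →
      ∫⁻ t in Ici (0 : ℝ), ‖x t‖ₑ ^ 2 ≤ ENNReal.ofReal (G r) + ENNReal.ofReal (M r) * ‖x 0‖ₑ ^ 2)
    {y : ℝ → E}
    (hy : ∀ t ∈ Icc 0 τ, HasDerivWithinAt y (S t (y t) + ∑ r ∈ s, v r t) (Ici 0) t) :
    ∫ t in (0 : ℝ)..τ, ‖y t‖ ^ 2 ≤ s.card * ∑ r ∈ s, G r + (∑ r ∈ s, M r) * ‖y 0‖ ^ 2 := by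
  have hcard : (0 : ℝ) < s.card := by exact_mod_cast hs.card_pos
  -- The initial value is shared equally among the channels. The offsets then carry `s.card *
  -- (s.card)⁻¹ ^ 2 ≤ 1`, so they need no factor `s.card`.
  have hex : ∀ r ∈ s, ∃ x : ℝ → E, Continuous x ∧ x 0 = (s.card : ℝ)⁻¹ • y 0 ∧
      IsForcedSolution S ((Icc 0 τ).indicator (v r)) x := fun r hr =>
    exists_isForcedSolution_indicator hS hK (hv r hr) _
  choose! x hxc hx0 hxs using hex
  have hsum : IsForcedSolution S (fun t => ∑ r ∈ s, (Icc 0 τ).indicator (v r) t)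
      (fun t => ∑ r ∈ s, x r t) := by
    intro t ht
    have e : (fun a => S a (∑ r ∈ s, x r a) + ∑ r ∈ s, (Icc 0 τ).indicator (v r) a) =
        fun a => ∑ r ∈ s, (S a (x r a) + (Icc 0 τ).indicator (v r) a) := by
      ext a; rw [map_sum, Finset.sum_add_distrib]
    rw [e]
    refine ⟨by simpa only [Finset.sum_fn] using
      IntervalIntegrable.sum s fun r hr => (hxs r hr t ht).1, ?_⟩
    rw [intervalIntegral.integral_finsetSum fun r hr => (hxs r hr t ht).1,
      ← Finset.sum_add_distrib]
    exact Finset.sum_congr rfl fun r hr => (hxs r hr t ht).2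
  have hxy : EqOn (fun t => ∑ r ∈ s, x r t) y (Icc 0 τ) := by
    refine hsum.eqOn_of_hasDerivWithinAt hS hK (v := fun t => ∑ r ∈ s, v r t)
      (continuous_finsetSum _ hv) (fun t ht => ?_) (continuous_finsetSum _ hxc) hy ?_
    · simp [indicator_of_mem ht]
    · rw [Finset.sum_congr rfl hx0, Finset.sum_const, ← Nat.cast_smul_eq_nsmul ℝ, smul_smul,
        mul_inv_cancel₀ hcard.ne', one_smul]
  have hone : ∀ r ∈ s, ∫ t in (0 : ℝ)..τ, ‖x r t‖ ^ 2 ≤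
      G r + M r * ((s.card : ℝ)⁻¹ ^ 2 * ‖y 0‖ ^ 2) := by
    intro r hr
    have hn0 : 0 ≤ G r + M r * ((s.card : ℝ)⁻¹ ^ 2 * ‖y 0‖ ^ 2) := by
      have := hM r hr; have := hG r hr; positivity
    rw [intervalIntegral.integral_of_le hτ, integral_eq_lintegral_of_nonneg_ae
      (Filter.Eventually.of_forall fun _ => by positivity)
      (by have := hxc r hr; exact Continuous.aestronglyMeasurable (by fun_prop))]
    refine ENNReal.toReal_le_of_le_ofReal hn0 ?_
    calc ∫⁻ t in Ioc 0 τ, ENNReal.ofReal (‖x r t‖ ^ 2)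
        = ∫⁻ t in Ioc 0 τ, ‖x r t‖ₑ ^ 2 := by
          simp only [ENNReal.ofReal_pow (norm_nonneg _), ofReal_norm]
      _ ≤ ∫⁻ t in Ici 0, ‖x r t‖ₑ ^ 2 :=
          lintegral_mono_set (Ioc_subset_Icc_self.trans Icc_subset_Ici_self)
      _ ≤ _ := hgain r hr _ (hxs r hr)
      _ = _ := by
          rw [ENNReal.ofReal_add (hG r hr) (by have := hM r hr; positivity),
            ENNReal.ofReal_mul (hM r hr), hx0 r hr, ← ofReal_norm, norm_smul, norm_inv,
            Real.norm_natCast, ← ENNReal.ofReal_pow (by positivity), mul_pow]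
  have hint : ∀ r ∈ s, IntervalIntegrable (fun t => ‖x r t‖ ^ 2) volume 0 τ := fun r hr => by
    have := hxc r hr; exact Continuous.intervalIntegrable (by fun_prop) _ _
  calc ∫ t in (0 : ℝ)..τ, ‖y t‖ ^ 2
      = ∫ t in (0 : ℝ)..τ, ‖∑ r ∈ s, x r t‖ ^ 2 := by
        refine intervalIntegral.integral_congr fun t ht => ?_
        rw [uIcc_of_le hτ] at ht
        simp only [← hxy ht]
    _ ≤ ∫ t in (0 : ℝ)..τ, s.card * ∑ r ∈ s, ‖x r t‖ ^ 2 := by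
        refine intervalIntegral.integral_mono_on hτ ?_ ?_ fun t _ => ?_
        · exact Continuous.intervalIntegrable
            ((continuous_finsetSum _ hxc).norm.pow 2) _ _
        · simpa only [Finset.sum_fn] using (IntervalIntegrable.sum s hint).const_mul (s.card : ℝ)
        · refine (pow_le_pow_left₀ (norm_nonneg _) (norm_sum_le _ _) 2).trans ?_
          exact sq_sum_le_card_mul_sum_sq
    _ = s.card * ∑ r ∈ s, ∫ t in (0 : ℝ)..τ, ‖x r t‖ ^ 2 := by
        rw [intervalIntegral.integral_const_mul, intervalIntegral.integral_finsetSum hint]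
    _ ≤ s.card * ∑ r ∈ s, (G r + M r * ((s.card : ℝ)⁻¹ ^ 2 * ‖y 0‖ ^ 2)) := by
        gcongr with r hr; exact hone r hr
    _ = s.card * ∑ r ∈ s, G r + (s.card : ℝ)⁻¹ * ((∑ r ∈ s, M r) * ‖y 0‖ ^ 2) := by
        rw [Finset.sum_add_distrib, ← Finset.sum_mul]
        field_simp
    _ ≤ s.card * ∑ r ∈ s, G r + 1 * ((∑ r ∈ s, M r) * ‖y 0‖ ^ 2) := by
        have := Finset.sum_nonneg hM
        gcongr
        exact inv_le_one_of_one_le₀ (by exact_mod_cast hs.card_pos)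
    _ = _ := by rw [one_mul]

end Superposition

/-! ### Nonnegative matrices of spectral radius less than one -/

section NonnegMatrix

variable {P : Type*} [Fintype P] [DecidableEq P]

/-- Gelfand's formula for the `ℓ^∞` operator norm, which is the largest absolute row sum. -/
theorem exists_pow_row_sum_lt_one {G : Matrix P P ℝ} (hρ : specRad G < 1) :
    ∃ (m : ℕ) (θ : ℝ), 0 ≤ θ ∧ θ < 1 ∧ ∀ p, ∑ q, |(G ^ m) p q| ≤ θ := by
  let _ : NormedRing (Matrix P P ℂ) := Matrix.linftyOpNormedRing
  let _ : NormedAlgebra ℂ (Matrix P P ℂ) := Matrix.linftyOpNormedAlgebra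
  have hlim := spectrum.pow_nnnorm_pow_one_div_tendsto_nhds_spectralRadius
    (G.map Complex.ofReal)
  obtain ⟨m, hm, hm0⟩ := ((hlim.eventually_lt_const hρ).and
    (Filter.eventually_gt_atTop 0)).exists
  have hlt : ‖(G.map Complex.ofReal) ^ m‖₊ < 1 := by
    by_contra hge
    refine absurd hm (not_lt.2 (ENNReal.one_le_rpow ?_ (by positivity)))
    exact_mod_cast not_lt.1 hge
  refine ⟨m, ‖(G.map Complex.ofReal) ^ m‖, norm_nonneg _, by exact_mod_cast hlt, fun p => ?_⟩
  have hmap : (G.map Complex.ofReal) ^ m = (G ^ m).map Complex.ofReal :=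
    (Matrix.map_pow G Complex.ofRealHom m).symm
  rw [hmap, Matrix.linfty_opNorm_def]
  refine le_trans (le_of_eq ?_) (NNReal.coe_le_coe.2
    (Finset.le_sup (f := fun i => ∑ j, ‖(G ^ m).map Complex.ofReal i j‖₊) (Finset.mem_univ p)))
  push_cast
  simp

/-- A nonnegative matrix preserves inequalities, so `z ≤ G z + b` can be substituted into itself `m`
times. -/
theorem exists_le_pow_mulVec_add {G : Matrix P P ℝ} (hG : ∀ p q, 0 ≤ G p q) (m : ℕ) :
    ∃ c : ℝ, 0 ≤ c ∧ ∀ (z : P → ℝ) (b : ℝ), 0 ≤ b → (∀ p, z p ≤ (G *ᵥ z) p + b) →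
      ∀ p, z p ≤ ((G ^ m) *ᵥ z) p + c * b := by
  induction m with
  | zero => exact ⟨0, le_rfl, fun z b _ _ p => by simp⟩
  | succ m ih =>
    obtain ⟨c, hc, h⟩ := ih
    have hGs : 0 ≤ ∑ p, ∑ q, G p q :=
      Finset.sum_nonneg fun p _ => Finset.sum_nonneg fun q _ => hG p q
    refine ⟨(∑ p, ∑ q, G p q) * c + 1, by positivity, fun z b hb hz p => (hz p).trans ?_⟩
    have h1 : (G *ᵥ z) p ≤ (G *ᵥ fun q => ((G ^ m) *ᵥ z) q + c * b) p :=
      Finset.sum_le_sum fun q _ => mul_le_mul_of_nonneg_left (h z b hb hz q) (hG p q)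
    have h2 : (G *ᵥ fun q => ((G ^ m) *ᵥ z) q + c * b) p =
        ((G ^ (m + 1)) *ᵥ z) p + (∑ q, G p q) * (c * b) := by
      rw [pow_succ', ← Matrix.mulVec_mulVec, Finset.sum_mul]
      simp only [Matrix.mulVec, dotProduct, mul_add, Finset.sum_add_distrib]
    have h3 : ∑ q, G p q ≤ ∑ p, ∑ q, G p q :=
      Finset.single_le_sum (f := fun p => ∑ q, G p q)
        (fun p _ => Finset.sum_nonneg fun q _ => hG p q) (Finset.mem_univ p)
    have h4 : (∑ q, G p q) * (c * b) ≤ (∑ p, ∑ q, G p q) * (c * b) := by gcongr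
    linarith

/-- With row sums of `|G ^ m|` at most `θ < 1`, the largest entry of `z` satisfies `z_max ≤ θ z_max
+ c b`. No Perron eigenvector is required. -/
theorem exists_bound_of_le_mulVec_add {G : Matrix P P ℝ} (hG : ∀ p q, 0 ≤ G p q)
    (hρ : specRad G < 1) :
    ∃ C : ℝ, 0 ≤ C ∧ ∀ (z : P → ℝ) (b : ℝ), (∀ p, 0 ≤ z p) → 0 ≤ b →
      (∀ p, z p ≤ (G *ᵥ z) p + b) → ∀ p, z p ≤ C * b := by
  obtain ⟨m, θ, hθ0, hθ1, hrow⟩ := exists_pow_row_sum_lt_one hρ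
  obtain ⟨c, hc, h⟩ := exists_le_pow_mulVec_add hG m
  have h1θ : 0 < 1 - θ := by linarith
  refine ⟨c / (1 - θ), by positivity, fun z b hz hb hzb p => ?_⟩
  obtain ⟨p₀, -, hp₀⟩ := Finset.exists_max_image Finset.univ z ⟨p, Finset.mem_univ p⟩
  refine (hp₀ p (Finset.mem_univ p)).trans ?_
  have h1 : ((G ^ m) *ᵥ z) p₀ ≤ θ * z p₀ := calc
    ((G ^ m) *ᵥ z) p₀ ≤ ∑ q, |(G ^ m) p₀ q| * z p₀ :=
        Finset.sum_le_sum fun q _ => (mul_le_mul_of_nonneg_right (le_abs_self _) (hz q)).trans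
          (mul_le_mul_of_nonneg_left (hp₀ q (Finset.mem_univ q)) (abs_nonneg _))
    _ = (∑ q, |(G ^ m) p₀ q|) * z p₀ := by rw [Finset.sum_mul]
    _ ≤ θ * z p₀ := mul_le_mul_of_nonneg_right (hrow p₀) (hz p₀)
  have h2 := h z b hb hzb p₀
  rw [div_mul_eq_mul_div, le_div_iff₀ h1θ]
  linarith

theorem exists_bound_of_le_mulVec_pair {P Q : Type*} [Fintype P] [DecidableEq P] [Fintype Q]
    {Γ : Matrix P P ℝ} {Υ : Matrix P Q ℝ} {Δ : Matrix Q P ℝ} (hΓ : ∀ p q, 0 ≤ Γ p q)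
    (hΥ : ∀ p k, 0 ≤ Υ p k) (hΔ : ∀ k q, 0 ≤ Δ k q) (hρ : specRad (Υ * Δ + Γ) < 1) :
    ∃ C : ℝ, 0 ≤ C ∧ ∀ (z : P → ℝ) (ξ : Q → ℝ) (b : ℝ), (∀ p, 0 ≤ z p) → 0 ≤ b →
      (∀ p, z p ≤ (Γ *ᵥ z) p + (Υ *ᵥ ξ) p + b) → (∀ k, ξ k ≤ (Δ *ᵥ z) k + b) →
      (∀ p, z p ≤ C * b) ∧ ∀ k, ξ k ≤ C * b := by
  have hυ0 : ∀ p, 0 ≤ ∑ k, Υ p k := fun p => Finset.sum_nonneg fun k _ => hΥ p k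
  have hd0 : ∀ k, 0 ≤ ∑ q, Δ k q := fun k => Finset.sum_nonneg fun q _ => hΔ k q
  obtain ⟨υ, hυ', hυ⟩ : ∃ υ : ℝ, 0 ≤ υ ∧ ∀ p, ∑ k, Υ p k ≤ υ :=
    ⟨∑ p, ∑ k, Υ p k, Finset.sum_nonneg fun p _ => hυ0 p, fun p =>
      Finset.single_le_sum (f := fun p => ∑ k, Υ p k) (fun p _ => hυ0 p) (Finset.mem_univ p)⟩
  obtain ⟨d, hd', hd⟩ : ∃ d : ℝ, 0 ≤ d ∧ ∀ k, ∑ q, Δ k q ≤ d :=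
    ⟨∑ k, ∑ q, Δ k q, Finset.sum_nonneg fun k _ => hd0 k, fun k =>
      Finset.single_le_sum (f := fun k => ∑ q, Δ k q) (fun k _ => hd0 k) (Finset.mem_univ k)⟩
  obtain ⟨C, hC, hsg⟩ := exists_bound_of_le_mulVec_add (G := Υ * Δ + Γ) (fun p q => add_nonneg
    (Finset.sum_nonneg fun k _ => mul_nonneg (hΥ p k) (hΔ k q)) (hΓ p q)) hρ
  -- The first summand bounds `z`. The second bounds `ξ ≤ Δ z + b` once `z` is bounded.
  refine ⟨C * (υ + 1) + (d * (C * (υ + 1)) + 1), by positivity, fun z ξ b hz0 hb hz hξ => ?_⟩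
  have hz' : ∀ p, z p ≤ C * ((υ + 1) * b) := by
    refine hsg z _ hz0 (by positivity) fun p => (hz p).trans ?_
    have h1 : (Υ *ᵥ ξ) p ≤ (Υ *ᵥ fun k => (Δ *ᵥ z) k + b) p :=
      Finset.sum_le_sum fun k _ => mul_le_mul_of_nonneg_left (hξ k) (hΥ p k)
    have h2 : (Υ *ᵥ fun k => (Δ *ᵥ z) k + b) p = ((Υ * Δ) *ᵥ z) p + (∑ k, Υ p k) * b := by
      rw [← Matrix.mulVec_mulVec, Finset.sum_mul]
      simp only [Matrix.mulVec, dotProduct, mul_add, Finset.sum_add_distrib]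
    have h3 : (∑ k, Υ p k) * b ≤ υ * b := mul_le_mul_of_nonneg_right (hυ p) hb
    rw [Matrix.add_mulVec, Pi.add_apply]
    linarith
  have hB : 0 ≤ C * (υ + 1) * b := by positivity
  have hB' : 0 ≤ d * (C * (υ + 1) * b) := by positivity
  refine ⟨fun p => ?_, fun k => ?_⟩
  · have := hz' p
    linarith
  · have h1 : (Δ *ᵥ z) k ≤ d * (C * ((υ + 1) * b)) := by
      refine (Finset.sum_le_sum fun q _ => mul_le_mul_of_nonneg_left (hz' q) (hΔ k q)).trans ?_
      rw [← Finset.sum_mul]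
      exact mul_le_mul_of_nonneg_right (hd k) (by positivity)
    have := hξ k
    linarith

end NonnegMatrix

/-! ### From square integrability to exponential decay -/

section Datko

variable {E : Type*} [NormedAddCommGroup E] [InnerProductSpace ℝ E]

/-- Integrate `(‖y‖²)' = 2⟪y, y'⟫ ≤ 2 L ‖y‖²` and use the energy bound on the right. The one-sided
inequality form of the fundamental theorem avoids any integrability of `y'`. -/
theorem sq_norm_le_of_integral_le {L C : ℝ} (hL : 0 ≤ L) {y y' : ℝ → E}
    (hy : ∀ t, 0 ≤ t → HasDerivWithinAt y (y' t) (Ici 0) t)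
    (hyL : ∀ t, 0 ≤ t → ‖y' t‖ ≤ L * ‖y t‖)
    (hC : ∀ s t, 0 ≤ s → s ≤ t → ∫ r in s..t, ‖y r‖ ^ 2 ≤ C * ‖y s‖ ^ 2)
    {s t : ℝ} (hs : 0 ≤ s) (hst : s ≤ t) : ‖y t‖ ^ 2 ≤ (1 + 2 * L * C) * ‖y s‖ ^ 2 := by
  have hyc : ContinuousOn y (Icc s t) := fun r hr =>
    (hy r (hs.trans hr.1)).continuousWithinAt.mono fun q hq => hs.trans hq.1
  have hder : ∀ r ∈ Ioo s t, HasDerivWithinAt (fun r => ‖y r‖ ^ 2) (2 * inner ℝ (y r) (y' r))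
      (Ioi r) r := fun r hr =>
    ((hy r (hs.trans hr.1.le)).mono fun q hq => (hs.trans hr.1.le).trans (le_of_lt hq)).norm_sq
  have hle := intervalIntegral.sub_le_integral_of_hasDeriv_right_of_le (g := fun r => ‖y r‖ ^ 2)
    (g' := fun r => 2 * inner ℝ (y r) (y' r)) (φ := fun r => 2 * L * ‖y r‖ ^ 2) hst
    (hyc.norm.pow 2) hder ((continuousOn_const.mul (hyc.norm.pow 2)).integrableOn_Icc)
    (fun r hr => by
      have h1 := real_inner_le_norm (y r) (y' r)
      have h2 := hyL r (hs.trans hr.1.le)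
      have h3 := mul_le_mul_of_nonneg_left h2 (norm_nonneg (y r))
      nlinarith)
  rw [intervalIntegral.integral_const_mul] at hle
  have := mul_le_mul_of_nonneg_left (hC s t hs hst) (by positivity : 0 ≤ 2 * L)
  linarith

/-- By the previous bound `‖y (s + τ)‖²` is at most `B` times its value at any earlier time in the
window. Averaging over the window gives `τ ‖y (s + τ)‖² ≤ B C ‖y s‖²`, so the norm halves over a
long enough window. -/
theorem exists_exponential_bound {L C : ℝ} (hL : 0 ≤ L) (hC : 0 ≤ C) :
    ∃ K c : ℝ, 0 < K ∧ 0 < c ∧ ∀ y y' : ℝ → E,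
      (∀ t, 0 ≤ t → HasDerivWithinAt y (y' t) (Ici 0) t) →
      (∀ t, 0 ≤ t → ‖y' t‖ ≤ L * ‖y t‖) →
      (∀ s t, 0 ≤ s → s ≤ t → ∫ r in s..t, ‖y r‖ ^ 2 ≤ C * ‖y s‖ ^ 2) →
      ∀ s t, 0 ≤ s → s ≤ t → ‖y t‖ ≤ K * Real.exp (-c * (t - s)) * ‖y s‖ := by
  set B : ℝ := 1 + 2 * L * C with hB
  have hB1 : 1 ≤ B := by have : 0 ≤ 2 * L * C := by positivity
                         linarith
  -- Chosen so that `B C ≤ τ / 4`, a factor `1/4` for the square of the norm; the `+ 1` keeps `τ`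
  -- positive.
  set τ : ℝ := 4 * (B * C + 1) with hτ
  have hτ0 : 0 < τ := by positivity
  have hl2 : 0 < Real.log 2 := Real.log_pos one_lt_two
  refine ⟨2 * B, Real.log 2 / τ, by positivity, by positivity, fun y y' hy hyL hyC => ?_⟩
  have hbd : ∀ s t, 0 ≤ s → s ≤ t → ‖y t‖ ^ 2 ≤ B * ‖y s‖ ^ 2 := fun s t hs hst =>
    sq_norm_le_of_integral_le hL hy hyL hyC hs hst
  have hhalf : ∀ s, 0 ≤ s → ‖y (s + τ)‖ ≤ ‖y s‖ / 2 := by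
    intro s hs
    have hsτ : s ≤ s + τ := by linarith
    have hyc : ContinuousOn y (Icc s (s + τ)) := fun r hr =>
      (hy r (hs.trans hr.1)).continuousWithinAt.mono fun q hq => hs.trans hq.1
    have h1 : ∫ _ in s..(s + τ), ‖y (s + τ)‖ ^ 2 ≤ ∫ r in s..(s + τ), B * ‖y r‖ ^ 2 :=
      intervalIntegral.integral_mono_on hsτ intervalIntegrable_const
        ((continuousOn_const.mul (hyc.norm.pow 2)).intervalIntegrable_of_Icc hsτ)
        (fun r hr => hbd r _ (hs.trans hr.1) hr.2)
    rw [intervalIntegral.integral_const, intervalIntegral.integral_const_mul, smul_eq_mul,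
      add_sub_cancel_left] at h1
    have h2 := mul_le_mul_of_nonneg_left (hyC s _ hs hsτ) (by positivity : 0 ≤ B)
    have h3 : τ * ‖y (s + τ)‖ ^ 2 ≤ τ * (‖y s‖ / 2) ^ 2 := by
      have : 0 ≤ ‖y s‖ ^ 2 := by positivity
      calc _ ≤ B * C * ‖y s‖ ^ 2 := by linarith
        _ ≤ (B * C + 1) * ‖y s‖ ^ 2 := by linarith
        _ = _ := by rw [hτ]; ring
    exact le_of_sq_le_sq (le_of_mul_le_mul_left h3 hτ0) (by positivity)
  have hiter : ∀ (k : ℕ) (s : ℝ), 0 ≤ s → ‖y (s + k * τ)‖ ≤ (1 / 2) ^ k * ‖y s‖ := by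
    intro k s hs
    induction k with
    | zero => simp
    | succ k ih =>
      have := hhalf (s + k * τ) (by positivity)
      rw [pow_succ, show s + ((k + 1 : ℕ) : ℝ) * τ = s + k * τ + τ by push_cast; ring]
      linarith
  intro s t hs hst
  obtain ⟨k, hk1, hk2⟩ : ∃ k : ℕ, k * τ ≤ t - s ∧ t - s < (k + 1) * τ := by
    refine ⟨⌊(t - s) / τ⌋₊, ?_, ?_⟩
    · rw [← le_div_iff₀ hτ0]
      exact Nat.floor_le (div_nonneg (by linarith) hτ0.le)
    · rw [← div_lt_iff₀ hτ0]
      exact Nat.lt_floor_add_one _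
  have h1 : ‖y t‖ ≤ B * ‖y (s + k * τ)‖ := by
    refine le_of_sq_le_sq ((hbd (s + k * τ) t (by positivity) (by linarith)).trans ?_)
      (by positivity)
    rw [mul_pow]
    gcongr
    nlinarith
  -- The factor `2` pays for the incomplete last window, as `k` is only the integer part of `(t - s)
  -- / τ`.
  have h2 : (1 / 2 : ℝ) ^ k ≤ 2 * Real.exp (-(Real.log 2 / τ) * (t - s)) := by
    have e2 : ∀ a : ℝ, Real.exp (a * Real.log 2) = 2 ^ a := fun a => by
      rw [mul_comm, ← Real.rpow_def_of_pos two_pos]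
    have h3 : (t - s) / τ ≤ k + 1 := by rw [div_le_iff₀ hτ0]; exact hk2.le
    calc (1 / 2 : ℝ) ^ k = 2 * Real.exp (-((k : ℝ) + 1) * Real.log 2) := by
          rw [e2, Real.rpow_neg two_pos.le, Real.rpow_add two_pos, Real.rpow_one,
            Real.rpow_natCast]
          simp
      _ ≤ _ := by
          refine mul_le_mul_of_nonneg_left (Real.exp_le_exp.2 ?_) two_pos.le
          rw [show -(Real.log 2 / τ) * (t - s) = -((t - s) / τ) * Real.log 2 by ring]
          exact mul_le_mul_of_nonneg_right (neg_le_neg h3) hl2.le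
  calc ‖y t‖ ≤ B * ((1 / 2) ^ k * ‖y s‖) := h1.trans (by gcongr; exact hiter k s hs)
    _ ≤ B * ((2 * Real.exp (-(Real.log 2 / τ) * (t - s))) * ‖y s‖) := by gcongr
    _ = _ := by ring

end Datko

/-! ### Skew-symmetric matrices and their blocks -/

section Skew

variable {ι : Type*}

/-- `X` is skew-symmetric. -/
def IsSkew (X : ι → ι → ℝ) : Prop := ∀ a b, X b a = -X a b

theorem IsSkew.self_eq_zero {X : ι → ι → ℝ} (hX : IsSkew X) (a : ι) : X a a = 0 := by
  have := hX a a
  linarith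

variable [LinearOrder ι]

/-- The skew-symmetric array whose strictly upper triangular entries are `y`. -/
def skew (y : OrdPair ι → ℝ) (a b : ι) : ℝ :=
  if h : a < b then y ⟨(a, b), h⟩ else if h : b < a then -y ⟨(b, a), h⟩ else 0

theorem isSkew_skew (y : OrdPair ι → ℝ) : IsSkew (skew y) := by
  intro a b
  rcases lt_trichotomy a b with h | rfl | h
  · simp [skew, h, h.not_gt]
  · simp [skew]
  · simp [skew, h, h.not_gt]

theorem skew_apply (y : OrdPair ι → ℝ) (p : OrdPair ι) : skew y p.1.1 p.1.2 = y p := by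
  simp [skew, p.2]

theorem continuous_skew : Continuous (skew : (OrdPair ι → ℝ) → ι → ι → ℝ) := by
  refine continuous_pi fun a => continuous_pi fun b => ?_
  unfold skew
  split_ifs <;> fun_prop

theorem sum_ordPair {M : Type*} [AddCommMonoid M] [Fintype ι] (F : ι → ι → M) :
    ∑ p : OrdPair ι, F p.1.1 p.1.2 = ∑ a, ∑ b, if a < b then F a b else 0 := by
  rw [← Fintype.sum_prod_type' (f := fun a b => if a < b then F a b else 0), ← Finset.sum_filter]
  exact (Finset.sum_subtype _ (by simp) fun p : ι × ι => F p.1 p.2).symm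

/-- The derivative `A X + X Aᵀ`. -/
theorem addCompound2_mulVec [Fintype ι] (A : Matrix ι ι ℝ) {X : ι → ι → ℝ} (hX : IsSkew X)
    (p : OrdPair ι) :
    (addCompound2 A *ᵥ fun q => X q.1.1 q.1.2) p =
      ∑ c, (A p.1.1 c * X c p.1.2 + X p.1.1 c * A p.1.2 c) := by
  obtain ⟨⟨a, b⟩, hab⟩ := p
  -- Skew-symmetry rewrites each term through the stored entries only; the minus sign for `c > b`
  -- produces the negative terms of `addCompound2`.
  have h1 : ∀ c, A a c * X c b =
      (if c < b then A a c * X c b else 0) - (if b < c then A a c * X b c else 0) := by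
    intro c
    rcases lt_trichotomy c b with h | rfl | h
    · simp [h, h.not_gt]
    · simp [hX.self_eq_zero]
    · simp [h, h.not_gt, hX b c]
  have h2 : ∀ c, X a c * A b c =
      (if a < c then A b c * X a c else 0) - (if c < a then A b c * X c a else 0) := by
    intro c
    rcases lt_trichotomy c a with h | rfl | h
    · simp [h, h.not_gt, hX c a, mul_comm]
    · simp [hX.self_eq_zero]
    · simp [h, h.not_gt, mul_comm]
  have e : (addCompound2 A *ᵥ fun q => X q.1.1 q.1.2) ⟨(a, b), hab⟩ =
      ∑ c, ∑ d, if c < d then ((if b = d then A a c else 0) + (if a = c then A b d else 0)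
        - (if b = c then A a d else 0) - (if a = d then A b c else 0)) * X c d else 0 :=
    sum_ordPair fun c d => ((if b = d then A a c else 0) + (if a = c then A b d else 0)
        - (if b = c then A a d else 0) - (if a = d then A b c else 0)) * X c d
  rw [e]
  have e2 : ∀ c d, (if c < d then ((if b = d then A a c else 0) + (if a = c then A b d else 0)
        - (if b = c then A a d else 0) - (if a = d then A b c else 0)) * X c d else 0) =
      (if b = d then if c < d then A a c * X c d else 0 else 0) +
      (if a = c then if c < d then A b d * X c d else 0 else 0) -
      (if b = c then if c < d then A a d * X c d else 0 else 0) -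
      (if a = d then if c < d then A b c * X c d else 0 else 0) := by
    intro c d
    split_ifs <;> ring
  simp only [e2, Finset.sum_sub_distrib, Finset.sum_add_distrib, Finset.sum_ite_eq,
    Finset.mem_univ, if_true]
  rw [Finset.sum_congr rfl fun c _ => h1 c, Finset.sum_congr rfl fun c _ => h2 c,
    Finset.sum_comm (f := fun c d => if a = c then if c < d then A b d * X c d else 0 else 0),
    Finset.sum_comm (f := fun c d => if b = c then if c < d then A a d * X c d else 0 else 0)]
  simp only [Finset.sum_sub_distrib, Finset.sum_ite_eq, Finset.mem_univ, if_true]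
  ring

end Skew

/-! ### Kronecker products and the matrices `Q`, `L`, `M` acting on vectorised blocks. -/

section Vectorisation

theorem kronecker_one_mulVec {ι κ μ : Type*} [Fintype κ] [Fintype μ] [DecidableEq μ]
    (A : Matrix ι κ ℝ) (v : κ × μ → ℝ) (p : ι × μ) :
    ((A ⊗ₖ (1 : Matrix μ μ ℝ)) *ᵥ v) p = ∑ c, A p.1 c * v (c, p.2) := by
  simp [Matrix.mulVec, dotProduct, Fintype.sum_prod_type, Matrix.one_apply]

theorem one_kronecker_mulVec {ι κ μ : Type*} [Fintype κ] [Fintype μ] [DecidableEq μ]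
    (A : Matrix ι κ ℝ) (v : μ × κ → ℝ) (p : μ × ι) :
    (((1 : Matrix μ μ ℝ) ⊗ₖ A) *ᵥ v) p = ∑ c, A p.2 c * v (p.1, c) := by
  simp [Matrix.mulVec, dotProduct, Fintype.sum_prod_type, Matrix.one_apply, ite_mul]

theorem matQ_mulVec (m l : ℕ) (v : Fin m × Fin l → ℝ) (p : Fin l × Fin m) :
    (matQ m l *ᵥ v) p = v p.swap := by
  simp [matQ, Matrix.mulVec, dotProduct]

theorem matL_mulVec (m : ℕ) (v : Fin m × Fin m → ℝ) (p : OrdPair (Fin m)) :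
    (matL m *ᵥ v) p = v p.1 := by
  simp [matL, Matrix.mulVec, dotProduct]

theorem matM_mulVec (m : ℕ) {X : Fin m → Fin m → ℝ} (hX : IsSkew X) (p : Fin m × Fin m) :
    (matM m *ᵥ fun q => X q.1.1 q.1.2) p = X p.1 p.2 := by
  obtain ⟨a, b⟩ := p
  have e : (matM m *ᵥ fun q => X q.1.1 q.1.2) (a, b) = ∑ c, ∑ d, if c < d then
      (if (a, b) = (c, d) then 1 else if (a, b).swap = (c, d) then -1 else 0) * X c d else 0 :=
    sum_ordPair fun c d =>
      (if (a, b) = (c, d) then 1 else if (a, b).swap = (c, d) then -1 else 0) * X c d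
  have e2 : ∀ c d, (if c < d then
      (if (a, b) = (c, d) then 1 else if (a, b).swap = (c, d) then -1 else 0) * X c d else 0) =
      (if a = c then if b = d then if c < d then X c d else 0 else 0 else 0) -
      (if b = c then if a = d then if c < d then X c d else 0 else 0 else 0) := by
    intro c d
    simp only [Prod.mk.injEq, Prod.swap]
    by_cases h : c < d
    · by_cases h1 : a = c <;> by_cases h2 : b = d <;> by_cases h3 : b = c <;>
        by_cases h4 : a = d <;> simp_all
    · simp [h]
  rw [e]
  simp only [e2, Finset.sum_sub_distrib, Finset.sum_ite_irrel, Finset.sum_const_zero,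
    Finset.sum_ite_eq, Finset.mem_univ, if_true]
  rcases lt_trichotomy a b with h | rfl | h
  · simp [h, h.not_gt]
  · simp [hX.self_eq_zero]
  · simp [h, h.not_gt, hX b a]

end Vectorisation

/-! ### The block form of `A X + X Aᵀ` and its identification with the coefficient matrices. -/

section Blocks

variable {N : ℕ} {n : Fin N → ℕ}

/-- The block `X_ij`. -/
def subBlock (i j : Fin N) (X : Idx n → Idx n → ℝ) (a : Fin (n i)) (b : Fin (n j)) : ℝ :=
  X (toLex ⟨i, a⟩) (toLex ⟨j, b⟩)

/-- The row vectorisation of `X_ij`. -/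
def vecBlock (i j : Fin N) (X : Idx n → Idx n → ℝ) (p : Fin (n i) × Fin (n j)) : ℝ :=
  subBlock i j X p.1 p.2

/-- The half-vectorisation of `X_ii`. -/
def halfBlock (i : Fin N) (X : Idx n → Idx n → ℝ) (p : OrdPair (Fin (n i))) : ℝ :=
  subBlock i i X p.1.1 p.1.2

/-- The row vectorisation of `A_ik X_kj`. -/
def leftTerm (i j k : Fin N) (A : BigMat n) (X : Idx n → Idx n → ℝ)
    (p : Fin (n i) × Fin (n j)) : ℝ :=
  ∑ c, block i k A p.1 c * subBlock k j X c p.2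

/-- The row vectorisation of `X_ik (A_jk)ᵀ`. -/
def rightTerm (i j k : Fin N) (A : BigMat n) (X : Idx n → Idx n → ℝ)
    (p : Fin (n i) × Fin (n j)) : ℝ :=
  ∑ c, block j k A p.2 c * subBlock i k X p.1 c

/-- The half-vectorisation of `A_ik X_ki + X_ik (A_ik)ᵀ`. -/
def diagTerm (i k : Fin N) (A : BigMat n) (X : Idx n → Idx n → ℝ)
    (p : OrdPair (Fin (n i))) : ℝ :=
  leftTerm i i k A X p.1 + rightTerm i i k A X p.1

theorem IsSkew.subBlock_swap {X : Idx n → Idx n → ℝ} (hX : IsSkew X) (i j : Fin N)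
    (a : Fin (n i)) (b : Fin (n j)) : subBlock j i X b a = -subBlock i j X a b := hX _ _

theorem IsSkew.subBlock_self {X : Idx n → Idx n → ℝ} (hX : IsSkew X) (i : Fin N) :
    IsSkew (subBlock i i X) := fun _ _ => hX _ _

theorem sum_idx (F : Idx n → ℝ) : ∑ c, F c = ∑ k, ∑ c : Fin (n k), F (toLex ⟨k, c⟩) := by
  rw [← Fintype.sum_sigma' (f := fun k c => F (toLex ⟨k, c⟩))]
  exact (Equiv.sum_comp toLex F).symm

theorem sum_leftTerm_add_rightTerm (i j : Fin N) (A : BigMat n) (X : Idx n → Idx n → ℝ)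
    (p : Fin (n i) × Fin (n j)) :
    ∑ c, (A (toLex ⟨i, p.1⟩) c * X c (toLex ⟨j, p.2⟩) +
      X (toLex ⟨i, p.1⟩) c * A (toLex ⟨j, p.2⟩) c) =
    ∑ k, leftTerm i j k A X p + ∑ k, rightTerm i j k A X p := by
  rw [sum_idx, ← Finset.sum_add_distrib]
  refine Finset.sum_congr rfl fun k _ => ?_
  rw [Finset.sum_add_distrib]
  congr 1
  exact Finset.sum_congr rfl fun c _ => mul_comm _ _

theorem offDyn_mulVec (i j : Fin N) (A : BigMat n) (X : Idx n → Idx n → ℝ) :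
    offDyn i j A *ᵥ vecBlock i j X = leftTerm i j i A X + rightTerm i j j A X := by
  ext p
  rw [offDyn, Matrix.add_mulVec, Pi.add_apply, kronecker_one_mulVec, one_kronecker_mulVec]
  rfl

theorem diagDyn_mulVec (i : Fin N) (A : BigMat n) {X : Idx n → Idx n → ℝ} (hX : IsSkew X) :
    diagDyn i A *ᵥ halfBlock i X = diagTerm i i A X := by
  ext p
  refine (addCompound2_mulVec (block i i A) (hX.subBlock_self i) p).trans ?_
  rw [Finset.sum_add_distrib]
  refine congrArg₂ (· + ·) rfl (Finset.sum_congr rfl fun c _ => mul_comm _ _)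

theorem matHjlt_mulVec (i j k : Fin N) (A : BigMat n) (X : Idx n → Idx n → ℝ) :
    matHjlt i j k A *ᵥ vecBlock k j X = leftTerm i j k A X := by
  ext p
  rw [matHjlt, kronecker_one_mulVec]
  rfl

/-- For `k > j` the stored block is `X_jk`, and `X_kj = -X_jkᵀ`: this is the origin of the sign and
of `Q` here and in `matHilt`, `matBlt` and `matBgt`. -/
theorem matHjgt_mulVec (i j k : Fin N) (A : BigMat n) {X : Idx n → Idx n → ℝ} (hX : IsSkew X) :
    matHjgt i j k A *ᵥ vecBlock j k X = leftTerm i j k A X := by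
  ext p
  rw [matHjgt, Matrix.neg_mulVec, Pi.neg_apply, ← Matrix.mulVec_mulVec, kronecker_one_mulVec,
    ← Finset.sum_neg_distrib]
  refine Finset.sum_congr rfl fun c _ => ?_
  rw [matQ_mulVec, vecBlock, ← mul_neg, Prod.fst_swap, Prod.snd_swap, ← hX.subBlock_swap]

theorem matHigt_mulVec (i j k : Fin N) (A : BigMat n) (X : Idx n → Idx n → ℝ) :
    matHigt i j k A *ᵥ vecBlock i k X = rightTerm i j k A X := by
  ext p
  rw [matHigt, one_kronecker_mulVec]
  rfl

theorem matHilt_mulVec (i j k : Fin N) (A : BigMat n) {X : Idx n → Idx n → ℝ} (hX : IsSkew X) :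
    matHilt i j k A *ᵥ vecBlock k i X = rightTerm i j k A X := by
  ext p
  rw [matHilt, Matrix.neg_mulVec, Pi.neg_apply, ← Matrix.mulVec_mulVec, one_kronecker_mulVec,
    ← Finset.sum_neg_distrib]
  refine Finset.sum_congr rfl fun c _ => ?_
  rw [matQ_mulVec, vecBlock, ← mul_neg, Prod.fst_swap, Prod.snd_swap, ← hX.subBlock_swap]

theorem matG1_mulVec (i j : Fin N) (A : BigMat n) {X : Idx n → Idx n → ℝ} (hX : IsSkew X) :
    matG1 i j A *ᵥ halfBlock i X = rightTerm i j i A X := by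
  ext p
  rw [matG1, ← Matrix.mulVec_mulVec, one_kronecker_mulVec]
  exact Finset.sum_congr rfl fun c _ =>
    congrArg _ (matM_mulVec _ (hX.subBlock_self i) (p.1, c))

theorem matG2_mulVec (i j : Fin N) (A : BigMat n) {X : Idx n → Idx n → ℝ} (hX : IsSkew X) :
    matG2 i j A *ᵥ halfBlock j X = leftTerm i j j A X := by
  ext p
  rw [matG2, ← Matrix.mulVec_mulVec, kronecker_one_mulVec]
  exact Finset.sum_congr rfl fun c _ =>
    congrArg _ (matM_mulVec _ (hX.subBlock_self j) (c, p.2))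

theorem matBlt_mulVec (i k : Fin N) (A : BigMat n) {X : Idx n → Idx n → ℝ} (hX : IsSkew X) :
    matBlt i k A *ᵥ vecBlock k i X = diagTerm i k A X := by
  ext p
  rw [matBlt, ← Matrix.mulVec_mulVec, matL_mulVec, Matrix.sub_mulVec, Pi.sub_apply,
    kronecker_one_mulVec, ← Matrix.mulVec_mulVec, one_kronecker_mulVec, sub_eq_add_neg,
    ← Finset.sum_neg_distrib]
  refine congrArg₂ (· + ·) rfl (Finset.sum_congr rfl fun c _ => ?_)
  rw [matQ_mulVec, vecBlock, ← mul_neg, Prod.fst_swap, Prod.snd_swap, ← hX.subBlock_swap]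

theorem matBgt_mulVec (i k : Fin N) (A : BigMat n) {X : Idx n → Idx n → ℝ} (hX : IsSkew X) :
    matBgt i k A *ᵥ vecBlock i k X = diagTerm i k A X := by
  ext p
  rw [matBgt, ← Matrix.mulVec_mulVec, matL_mulVec, Matrix.sub_mulVec, Pi.sub_apply,
    one_kronecker_mulVec, ← Matrix.mulVec_mulVec, kronecker_one_mulVec, sub_eq_add_neg, add_comm,
    ← Finset.sum_neg_distrib]
  refine congrArg₂ (· + ·) (Finset.sum_congr rfl fun c _ => ?_) rfl
  rw [matQ_mulVec, vecBlock, ← mul_neg, Prod.fst_swap, Prod.snd_swap, ← hX.subBlock_swap]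

@[fun_prop]
theorem continuous_block_apply (i j : Fin N) (a : Fin (n i)) (b : Fin (n j)) :
    Continuous fun A : BigMat n => block i j A a b :=
  continuous_id.matrix_elem _ _

@[fun_prop]
theorem continuous_subBlock_apply (i j : Fin N) (a : Fin (n i)) (b : Fin (n j)) :
    Continuous fun X : Idx n → Idx n → ℝ => subBlock i j X a b := by
  unfold subBlock; fun_prop

@[fun_prop]
theorem continuous_block (i j : Fin N) : Continuous (block i j : BigMat n → _) :=
  continuous_matrix fun a b => continuous_block_apply i j a b

theorem continuous_vecBlock (i j : Fin N) : Continuous (vecBlock (n := n) i j) :=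
  continuous_pi fun _ => continuous_subBlock_apply ..

theorem continuous_halfBlock (i : Fin N) : Continuous (halfBlock (n := n) i) :=
  continuous_pi fun _ => continuous_subBlock_apply ..

theorem continuous_kronecker_one {ι κ μ X : Type*} [DecidableEq μ] [TopologicalSpace X]
    {A : X → Matrix ι κ ℝ} (hA : Continuous A) :
    Continuous fun x => A x ⊗ₖ (1 : Matrix μ μ ℝ) :=
  continuous_matrix fun _ _ => (hA.matrix_elem _ _).mul continuous_const

theorem continuous_one_kronecker {ι κ μ X : Type*} [DecidableEq μ] [TopologicalSpace X]
    {A : X → Matrix ι κ ℝ} (hA : Continuous A) :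
    Continuous fun x => (1 : Matrix μ μ ℝ) ⊗ₖ A x :=
  continuous_matrix fun _ _ => continuous_const.mul (hA.matrix_elem _ _)

theorem continuous_addCompound2 {ι : Type*} [LinearOrder ι] :
    Continuous (addCompound2 : Matrix ι ι ℝ → _) := by
  refine continuous_matrix fun p q => ?_
  have h : ∀ a b, Continuous fun A : Matrix ι ι ℝ => A a b := fun a b =>
    continuous_id.matrix_elem a b
  have h' : ∀ (P : Prop) [Decidable P] (a b : ι),
      Continuous fun A : Matrix ι ι ℝ => if P then A a b else 0 := fun P _ a b => by
    by_cases hP : P <;> simp [hP, h, continuous_const]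
  exact (((h' _ _ _).add (h' _ _ _)).sub (h' _ _ _)).sub (h' _ _ _)

theorem continuous_offDyn (i j : Fin N) : Continuous (offDyn (n := n) i j) :=
  (continuous_kronecker_one (continuous_block i i)).add
    (continuous_one_kronecker (continuous_block j j))

theorem continuous_diagDyn (i : Fin N) : Continuous (diagDyn (n := n) i) :=
  continuous_addCompound2.comp (continuous_block i i)

theorem continuous_matHjlt (i j k : Fin N) : Continuous (matHjlt (n := n) i j k) :=
  continuous_kronecker_one (continuous_block i k)

theorem continuous_matHjgt (i j k : Fin N) : Continuous (matHjgt (n := n) i j k) :=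
  ((continuous_kronecker_one (continuous_block i k)).matrix_mul continuous_const).neg

theorem continuous_matHigt (i j k : Fin N) : Continuous (matHigt (n := n) i j k) :=
  continuous_one_kronecker (continuous_block j k)

theorem continuous_matHilt (i j k : Fin N) : Continuous (matHilt (n := n) i j k) :=
  ((continuous_one_kronecker (continuous_block j k)).matrix_mul continuous_const).neg

theorem continuous_matG1 (i j : Fin N) : Continuous (matG1 (n := n) i j) :=
  (continuous_one_kronecker (continuous_block j i)).matrix_mul continuous_const

theorem continuous_matG2 (i j : Fin N) : Continuous (matG2 (n := n) i j) :=
  (continuous_kronecker_one (continuous_block i j)).matrix_mul continuous_const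

theorem continuous_matBlt (i k : Fin N) : Continuous (matBlt (n := n) i k) :=
  continuous_const.matrix_mul ((continuous_kronecker_one (continuous_block i k)).sub
    ((continuous_one_kronecker (continuous_block i k)).matrix_mul continuous_const))

theorem continuous_matBgt (i k : Fin N) : Continuous (matBgt (n := n) i k) :=
  continuous_const.matrix_mul ((continuous_one_kronecker (continuous_block i k)).sub
    ((continuous_kronecker_one (continuous_block i k)).matrix_mul continuous_const))

theorem continuous_leftTerm (i j k : Fin N) :
    Continuous fun q : BigMat n × (Idx n → Idx n → ℝ) => leftTerm i j k q.1 q.2 := by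
  refine continuous_pi fun p => continuous_finsetSum _ fun c _ => ?_
  exact ((continuous_block_apply ..).comp continuous_fst).mul
    ((continuous_subBlock_apply ..).comp continuous_snd)

theorem continuous_rightTerm (i j k : Fin N) :
    Continuous fun q : BigMat n × (Idx n → Idx n → ℝ) => rightTerm i j k q.1 q.2 := by
  refine continuous_pi fun p => continuous_finsetSum _ fun c _ => ?_
  exact ((continuous_block_apply ..).comp continuous_fst).mul
    ((continuous_subBlock_apply ..).comp continuous_snd)

theorem continuous_diagTerm (i k : Fin N) :
    Continuous fun q : BigMat n × (Idx n → Idx n → ℝ) => diagTerm i k q.1 q.2 :=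
  continuous_pi fun p => ((continuous_apply p.1).comp (continuous_leftTerm i i k)).add
    ((continuous_apply p.1).comp (continuous_rightTerm i i k))

/-- The squared norm of the entries stored for the block `X_kl`: all of them if `k ≠ l`, the
strictly upper triangular ones if `k = l`. -/
def energy (k l : Fin N) (X : Idx n → Idx n → ℝ) : ℝ :=
  if k = l then ∑ p, halfBlock k X p ^ 2 else ∑ p, vecBlock k l X p ^ 2

theorem energy_self (k : Fin N) (X : Idx n → Idx n → ℝ) :
    energy k k X = ∑ p, halfBlock k X p ^ 2 := if_pos rfl

theorem energy_of_ne {k l : Fin N} (h : k ≠ l) (X : Idx n → Idx n → ℝ) :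
    energy k l X = ∑ p, vecBlock k l X p ^ 2 := if_neg h

theorem energy_nonneg (k l : Fin N) (X : Idx n → Idx n → ℝ) : 0 ≤ energy k l X := by
  unfold energy
  split_ifs <;> positivity

theorem IsSkew.energy_comm {X : Idx n → Idx n → ℝ} (hX : IsSkew X) (k l : Fin N) :
    energy k l X = energy l k X := by
  rcases eq_or_ne k l with rfl | h
  · rfl
  rw [energy_of_ne h, energy_of_ne h.symm, ← Equiv.sum_comp (Equiv.prodComm _ _)]
  refine Finset.sum_congr rfl fun p _ => ?_
  simp only [vecBlock, Equiv.prodComm_apply, Prod.fst_swap, Prod.snd_swap]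
  rw [hX.subBlock_swap, neg_sq]

theorem continuous_energy (k l : Fin N) : Continuous (energy (n := n) k l) := by
  unfold energy
  split_ifs
  · exact continuous_finsetSum _ fun p _ =>
      ((continuous_apply p).comp (continuous_halfBlock k)).pow 2
  · exact continuous_finsetSum _ fun p _ =>
      ((continuous_apply p).comp (continuous_vecBlock k l)).pow 2

end Blocks

/-! ### Systems with several input channels -/

section Channels

variable {N : ℕ} {n : Fin N → ℕ} {ι κ : Type*} [Fintype ι] [DecidableEq ι] [Fintype κ]

/-- The system `x' = S(A(t)) x + F(A(t), X(t))` has `L₂` gain at most `γ` with offset `M` from the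
signal with squared norm `Z (X(t))`, for inputs switched off after a finite time. -/
def ChannelGain (𝒥 : Set (BigMat n)) (S : BigMat n → Matrix ι ι ℝ)
    (F : BigMat n → (Idx n → Idx n → ℝ) → ι → ℝ) (Z : (Idx n → Idx n → ℝ) → ℝ) (γ M : ℝ) : Prop :=
  ∀ A : ℝ → BigMat n, Continuous A → (∀ t, A t ∈ 𝒥) →
  ∀ X : ℝ → Idx n → Idx n → ℝ, Continuous X → (∀ t, IsSkew (X t)) →
  ∀ τ : ℝ, 0 ≤ τ → ∀ x : ℝ → EuclideanSpace ℝ ι,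
    IsForcedSolution (fun t => Matrix.toEuclideanCLM (𝕜 := ℝ) (S (A t)))
      ((Icc 0 τ).indicator fun t => WithLp.toLp 2 (F (A t) (X t))) x →
    ∫⁻ t in Ici (0 : ℝ), ‖x t‖ₑ ^ 2 ≤
      ENNReal.ofReal (γ ^ 2 * ∫ t in (0 : ℝ)..τ, Z (X t)) + ENNReal.ofReal M * ‖x 0‖ₑ ^ 2

/-- Passing from the matrix `T` and its input to the term `F` and the energy `Z` hides the input
space, so channels with inputs of different dimensions fit in one family. The truncated input has
squared `L₂` norm `∫_0^τ Z`. -/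
theorem IsL2GainBound.exists_channelGain {𝒥 : Set (BigMat n)} {S : BigMat n → Matrix ι ι ℝ}
    {T : BigMat n → Matrix ι κ ℝ} {γ : ℝ} (h : IsL2GainBound (coeffSet 𝒥 S T) γ)
    (hS : Continuous S) (hT : Continuous T) {u : (Idx n → Idx n → ℝ) → κ → ℝ} (hu : Continuous u)
    {F : BigMat n → (Idx n → Idx n → ℝ) → ι → ℝ} (hF : ∀ A X, IsSkew X → T A *ᵥ u X = F A X)
    {Z : (Idx n → Idx n → ℝ) → ℝ} (hZ : ∀ X, IsSkew X → Z X = ∑ k, u X k ^ 2) :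
    ∃ M, 0 ≤ M ∧ ChannelGain 𝒥 S F Z γ M := by
  obtain ⟨M, hM, h⟩ := h
  refine ⟨M, hM.le, fun A hA hA𝒥 X hX hXs τ hτ x hx => ?_⟩
  have hv : Continuous fun t => (WithLp.toLp 2 (u (X t)) : EuclideanSpace ℝ κ) :=
    (PiLp.continuous_toLp 2 _).comp (hu.comp hX)
  have key := h (fun t => S (A t)) (fun t => T (A t)) (hS.comp hA).continuousOn
    (hT.comp hA).continuousOn (fun t _ => ⟨A t, hA𝒥 t, rfl⟩)
    ((Icc 0 τ).indicator fun t => WithLp.toLp 2 (u (X t)))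
    (hv.measurable.indicator measurableSet_Icc) x (by
      intro t ht
      have e : (fun s => (WithLp.toLp 2 (S (A s) *ᵥ (x s).ofLp + T (A s) *ᵥ
          ((Icc 0 τ).indicator (fun t => (WithLp.toLp 2 (u (X t)) : EuclideanSpace ℝ κ)) s).ofLp) :
            EuclideanSpace ℝ ι)) =
          fun s => Matrix.toEuclideanCLM (𝕜 := ℝ) (S (A s)) (x s) +
            (Icc 0 τ).indicator (fun t => WithLp.toLp 2 (F (A t) (X t))) s := by
        ext1 s
        rw [WithLp.toLp_add]
        congr 1
        by_cases hs : s ∈ Icc 0 τ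
        · rw [indicator_of_mem hs, indicator_of_mem hs, hF _ _ (hXs s)]
        · rw [indicator_of_notMem hs, indicator_of_notMem hs, WithLp.ofLp_zero,
            Matrix.mulVec_zero, WithLp.toLp_zero]
      rw [e]
      exact hx t ht)
  refine key.trans (le_of_eq ?_)
  congr 1
  rw [ENNReal.ofReal_mul (sq_nonneg γ)]
  congr 1
  have hvi : Continuous fun t => ‖(WithLp.toLp 2 (u (X t)) : EuclideanSpace ℝ κ)‖ ^ 2 := by
    fun_prop
  have e2 : (fun t => ‖(Icc 0 τ).indicator (fun t =>
      (WithLp.toLp 2 (u (X t)) : EuclideanSpace ℝ κ)) t‖ₑ ^ 2) =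
      (Icc 0 τ).indicator fun t => ENNReal.ofReal
        (‖(WithLp.toLp 2 (u (X t)) : EuclideanSpace ℝ κ)‖ ^ 2) := by
    ext1 t
    by_cases ht : t ∈ Icc 0 τ
    · rw [indicator_of_mem ht, indicator_of_mem ht, ENNReal.ofReal_pow (norm_nonneg _), ofReal_norm]
    · rw [indicator_of_notMem ht, indicator_of_notMem ht]
      simp
  rw [e2, lintegral_indicator measurableSet_Icc, Measure.restrict_restrict measurableSet_Icc,
    inter_eq_left.2 Icc_subset_Ici_self, intervalIntegral.integral_of_le hτ,
    ← integral_Icc_eq_integral_Ioc, ← ofReal_integral_eq_lintegral_ofReal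
      hvi.continuousOn.integrableOn_Icc (Filter.Eventually.of_forall fun _ => by positivity)]
  congr 1
  refine integral_congr_ae (Filter.Eventually.of_forall fun t => ?_)
  simp only
  rw [EuclideanSpace.norm_sq_eq, hZ _ (hXs t)]
  simp

theorem continuous_toEuclideanCLM : Continuous fun A : Matrix ι ι ℝ =>
    (Matrix.toEuclideanCLM (n := ι) (𝕜 := ℝ) A) :=
  LinearMap.continuous_of_finiteDimensional
    (Matrix.toEuclideanCLM (n := ι) (𝕜 := ℝ)).toAlgEquiv.toLinearMap

/-- Only the channels in `s` take part in the superposition, since the others contribute nothing.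
This is why the factor is the number of active channels. -/
theorem exists_multichannel_bound {C : Type*} {𝒥 : Set (BigMat n)} {P : Finset C}
    (hP : P.Nonempty) {S : BigMat n → Matrix ι ι ℝ} (hS : Continuous S)
    {F : C → BigMat n → (Idx n → Idx n → ℝ) → ι → ℝ}
    (hF : ∀ r ∈ P, Continuous fun q : BigMat n × (Idx n → Idx n → ℝ) => F r q.1 q.2)
    {Z : C → (Idx n → Idx n → ℝ) → ℝ} (hZ0 : ∀ r ∈ P, Z r 0 = 0) (hZ : ∀ r ∈ P, ∀ X, 0 ≤ Z r X)
    {γ : C → ℝ} (hgain : ∀ r ∈ P, ∃ M, 0 ≤ M ∧ ChannelGain 𝒥 S (F r) (Z r) (γ r) M)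
    {R : ℕ} {s : Finset C} (hsP : s ⊆ P) (hsR : s.card ≤ R)
    (hs : ∀ r ∈ P, r ∉ s → ∀ A ∈ 𝒥, ∀ X, IsSkew X → F r A X = 0) :
    ∃ M, 0 ≤ M ∧ ∀ A : ℝ → BigMat n, Continuous A → (∀ t, A t ∈ 𝒥) →
      ∀ X : ℝ → Idx n → Idx n → ℝ, Continuous X → (∀ t, IsSkew (X t)) →
      ∀ τ : ℝ, 0 ≤ τ → ∀ y : ℝ → EuclideanSpace ℝ ι,
      (∀ t ∈ Icc 0 τ, HasDerivWithinAt y (WithLp.toLp 2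
        (S (A t) *ᵥ (y t).ofLp + ∑ r ∈ P, F r (A t) (X t))) (Ici 0) t) →
      ∫ t in (0 : ℝ)..τ, ‖y t‖ ^ 2 ≤
        R * ∑ r ∈ P, γ r ^ 2 * (∫ t in (0 : ℝ)..τ, Z r (X t)) + M * ‖y 0‖ ^ 2 := by
  choose! M hM hMg using hgain
  refine ⟨∑ r ∈ P, M r, Finset.sum_nonneg hM, fun A hA hA𝒥 X hX hXs τ hτ y hy => ?_⟩
  -- Freezing `A` outside `[0, τ]` bounds the coefficients on `ℝ`, stays in `𝒥`, and leaves the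
  -- equation on `[0, τ]` unchanged.
  set A' : ℝ → BigMat n := fun t => A (projIcc 0 τ hτ t)
  have hA' : Continuous A' := hA.comp (continuous_subtype_val.comp continuous_projIcc)
  have hAA' : ∀ t ∈ Icc 0 τ, A' t = A t := fun t ht => by
    simp only [A', projIcc_of_mem hτ ht]
  obtain ⟨K, hK⟩ : ∃ K, ∀ t, ‖Matrix.toEuclideanCLM (𝕜 := ℝ) (S (A' t))‖ ≤ K := by
    have hc : Continuous fun t : Icc 0 τ => ‖Matrix.toEuclideanCLM (𝕜 := ℝ) (S (A t))‖ :=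
      (continuous_toEuclideanCLM.comp
        (hS.comp (hA.comp continuous_subtype_val))).norm
    obtain ⟨K, hK⟩ := (isCompact_range hc).bddAbove
    exact ⟨K, fun t => hK ⟨projIcc 0 τ hτ t, rfl⟩⟩
  have hSc : Continuous fun t => Matrix.toEuclideanCLM (𝕜 := ℝ) (S (A' t)) :=
    continuous_toEuclideanCLM.comp (hS.comp hA')
  have hv : ∀ Y : ℝ → Idx n → Idx n → ℝ, Continuous Y → ∀ r ∈ P, Continuous fun t =>
      (WithLp.toLp 2 (F r (A' t) (Y t)) : EuclideanSpace ℝ ι) := fun Y hY r hr =>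
    (PiLp.continuous_toLp 2 _).comp ((hF r hr).comp (hA'.prodMk hY))
  have hI : ∀ r ∈ P, 0 ≤ γ r ^ 2 * ∫ t in (0 : ℝ)..τ, Z r (X t) := fun r hr =>
    mul_nonneg (sq_nonneg _) (intervalIntegral.integral_nonneg hτ fun t _ => hZ r hr _)
  have hsumP : ∀ t, ∑ r ∈ P, F r (A' t) (X t) = ∑ r ∈ s, F r (A' t) (X t) := fun t =>
    (Finset.sum_subset hsP fun r hr hrs => hs r hr hrs _ (hA𝒥 _) _ (hXs t)).symm
  have hMs : ∀ s ⊆ P, ∑ r ∈ s, M r ≤ ∑ r ∈ P, M r := fun s h =>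
    Finset.sum_le_sum_of_subset_of_nonneg h fun r hr _ => hM r hr
  have hIs : ∑ r ∈ s, γ r ^ 2 * (∫ t in (0 : ℝ)..τ, Z r (X t)) ≤
      ∑ r ∈ P, γ r ^ 2 * ∫ t in (0 : ℝ)..τ, Z r (X t) :=
    Finset.sum_le_sum_of_subset_of_nonneg hsP fun r hr _ => hI r hr
  -- Without active channels the equation is `y' = S y`. The gain of any one channel, taken with
  -- zero input, still bounds its energy by the initial value; this is where `P` must be nonempty.
  rcases s.eq_empty_or_nonempty with rfl | hne
  · obtain ⟨r, hr⟩ := hP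
    have key := integral_sq_norm_le_of_channels hSc hK hτ (s := {r}) ⟨r, by simp⟩
      (v := fun r t => WithLp.toLp 2 (F r (A' t) 0))
      (fun r' hr' => hv (fun _ => 0) continuous_const r' (by simpa [Finset.mem_singleton.1 hr']))
      (M := M) (G := fun _ => 0) (by simpa using hM r hr) (by simp)
      (fun r' hr' x hx => by
        rw [Finset.mem_singleton] at hr'
        subst hr'
        have := hMg r' hr A' hA' (fun t => hA𝒥 _) (fun _ => 0) continuous_const
          (fun _ a b => by simp) τ hτ x hx
        simpa [hZ0 r' hr] using this) (y := y) (fun t ht => by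
          refine (hy t ht).congr_deriv ?_
          rw [← hAA' t ht, hsumP]
          simp only [Finset.sum_empty, add_zero, Finset.sum_singleton]
          rw [hs r hr (by simp) _ (hA𝒥 _) 0 (fun a b => by simp), WithLp.toLp_zero, add_zero]
          rfl)
    refine key.trans ?_
    have h1 := hMs {r} (by simpa using hr)
    have h2 := Finset.sum_nonneg hI
    simp only [Finset.sum_const_zero, mul_zero, zero_add]
    have h3 : 0 ≤ (R : ℝ) * ∑ r ∈ P, γ r ^ 2 * ∫ t in (0 : ℝ)..τ, Z r (X t) := by positivity
    nlinarith [sq_nonneg ‖y 0‖]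
  · have key := integral_sq_norm_le_of_channels hSc hK hτ hne
      (v := fun r t => WithLp.toLp 2 (F r (A' t) (X t)))
      (fun r hr => hv X hX r (hsP hr)) (M := M)
      (G := fun r => γ r ^ 2 * ∫ t in (0 : ℝ)..τ, Z r (X t)) (fun r hr => hM r (hsP hr))
      (fun r hr => hI r (hsP hr))
      (fun r hr x hx => hMg r (hsP hr) A' hA' (fun t => hA𝒥 _) X hX hXs τ hτ x hx) (y := y)
      (fun t ht => by
        refine (hy t ht).congr_deriv ?_
        rw [← hAA' t ht, hsumP, WithLp.toLp_add, WithLp.toLp_sum]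
        rfl)
    refine key.trans (add_le_add ?_ (mul_le_mul_of_nonneg_right (hMs s hsP) (sq_nonneg _)))
    exact mul_le_mul (by exact_mod_cast hsR) hIs
      (Finset.sum_nonneg fun r hr => hI r (hsP hr)) (by positivity)

end Channels

/-! ### The subsystems -/

section Subsystems

variable {N : ℕ} {n : Fin N → ℕ}

theorem active_of_mulVec_ne_zero {ι κ : Type*} [Fintype κ] {𝒥 : Set (BigMat n)}
    {T : BigMat n → Matrix ι κ ℝ} {A : BigMat n} (hA : A ∈ 𝒥) {u : κ → ℝ} (h : T A *ᵥ u ≠ 0) :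
    Active 𝒥 T :=
  ⟨A, hA, fun h0 => h (by rw [h0, Matrix.zero_mulVec])⟩

/-- The indices of the channels through which `F` acts nontrivially. -/
def activeIndices {β : Type*} (𝒥 : Set (BigMat n)) (P : Finset (Fin N))
    (F : Fin N → BigMat n → (Idx n → Idx n → ℝ) → β → ℝ) : Finset (Fin N) :=
  (Set.toFinite {k | k ∈ P ∧ ∃ A ∈ 𝒥, ∃ X, IsSkew X ∧ F k A X ≠ 0}).toFinset

theorem activeIndices_subset {β : Type*} (𝒥 : Set (BigMat n)) (P : Finset (Fin N))
    (F : Fin N → BigMat n → (Idx n → Idx n → ℝ) → β → ℝ) : activeIndices 𝒥 P F ⊆ P :=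
  fun _ hk => ((Set.Finite.mem_toFinset _).1 hk).1

theorem eq_zero_of_notMem_activeIndices {β : Type*} {𝒥 : Set (BigMat n)} {P : Finset (Fin N)}
    {F : Fin N → BigMat n → (Idx n → Idx n → ℝ) → β → ℝ} {k : Fin N} (hk : k ∈ P)
    (h : k ∉ activeIndices 𝒥 P F) {A : BigMat n} (hA : A ∈ 𝒥) {X : Idx n → Idx n → ℝ}
    (hX : IsSkew X) : F k A X = 0 := by
  by_contra hne
  exact h ((Set.Finite.mem_toFinset _).2 ⟨hk, A, hA, X, hX, hne⟩)

/-- In the block equation the channel from a diagonal block is just the index `k = j`, whereas `Rij`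
counts `G¹`, `G²` separately through `Fin 2`. This reconciles the two counts. -/
theorem card_le_ncard_add_ncard {s : Finset (Fin N)} {t : Set (Fin N)} {j : Fin N} {p : Prop}
    {q : Fin 2} (h : ∀ k ∈ s, k ∈ t ∨ k = j ∧ p) : s.card ≤ t.ncard + {r | r = q ∧ p}.ncard := by
  have h1 : (s : Set (Fin N)) ⊆ t ∪ {k | k = j ∧ p} := fun k hk => h k hk
  have h2 : {k : Fin N | k = j ∧ p}.ncard = {r : Fin 2 | r = q ∧ p}.ncard := by
    by_cases hp : p <;> simp [hp]
  rw [← ncard_coe_finset, ← h2]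
  exact (ncard_le_ncard h1 (toFinite _)).trans (ncard_union_le _ _)

theorem card_activeIndices_add_le_Rij (𝒥 : Set (BigMat n)) (i j : Fin N) :
    (activeIndices 𝒥 (Finset.univ.erase i) (leftTerm i j)).card +
      (activeIndices 𝒥 (Finset.univ.erase j) (rightTerm i j)).card ≤ Rij 𝒥 i j := by
  have hl : (activeIndices 𝒥 (Finset.univ.erase i) (leftTerm i j)).card ≤ _ + _ :=
    card_le_ncard_add_ncard (j := j) (p := Active 𝒥 (matG2 i j)) (q := 1)
      (t := {k : Fin N | k ≠ i ∧
        (k < j ∧ Active 𝒥 (matHjlt i j k) ∨ k > j ∧ Active 𝒥 (matHjgt i j k))}) (by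
    intro k hk
    obtain ⟨hki, A, hA, X, hX, hne⟩ := (Set.Finite.mem_toFinset _).1 hk
    have hki := Finset.ne_of_mem_erase hki
    rcases lt_trichotomy k j with h | rfl | h
    · rw [← matHjlt_mulVec] at hne
      exact Or.inl ⟨hki, Or.inl ⟨h, active_of_mulVec_ne_zero hA hne⟩⟩
    · rw [← matG2_mulVec i k A hX] at hne
      exact Or.inr ⟨rfl, active_of_mulVec_ne_zero hA hne⟩
    · rw [← matHjgt_mulVec i j k A hX] at hne
      exact Or.inl ⟨hki, Or.inr ⟨h, active_of_mulVec_ne_zero hA hne⟩⟩)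
  have hr : (activeIndices 𝒥 (Finset.univ.erase j) (rightTerm i j)).card ≤ _ + _ :=
    card_le_ncard_add_ncard (j := i) (p := Active 𝒥 (matG1 i j)) (q := 0)
      (t := {k : Fin N | k ≠ j ∧
        (k > i ∧ Active 𝒥 (matHigt i j k) ∨ k < i ∧ Active 𝒥 (matHilt i j k))}) (by
    intro k hk
    obtain ⟨hkj, A, hA, X, hX, hne⟩ := (Set.Finite.mem_toFinset _).1 hk
    have hkj := Finset.ne_of_mem_erase hkj
    rcases lt_trichotomy k i with h | rfl | h
    · rw [← matHilt_mulVec i j k A hX] at hne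
      exact Or.inl ⟨hkj, Or.inr ⟨h, active_of_mulVec_ne_zero hA hne⟩⟩
    · rw [← matG1_mulVec k j A hX] at hne
      exact Or.inr ⟨rfl, active_of_mulVec_ne_zero hA hne⟩
    · rw [← matHigt_mulVec] at hne
      exact Or.inl ⟨hkj, Or.inl ⟨h, active_of_mulVec_ne_zero hA hne⟩⟩)
  have hq : {q : Fin 2 | q = 0 ∧ Active 𝒥 (matG1 i j) ∨ q = 1 ∧ Active 𝒥 (matG2 i j)}.ncard =
      {q : Fin 2 | q = 0 ∧ Active 𝒥 (matG1 i j)}.ncard +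
      {q : Fin 2 | q = 1 ∧ Active 𝒥 (matG2 i j)}.ncard := by
    rw [← ncard_union_eq]
    · rfl
    · refine disjoint_left.2 fun q h0 h1 => ?_
      exact absurd (h0.1.symm.trans h1.1) (by decide)
  unfold Rij
  rw [hq]
  linarith

theorem card_activeIndices_le_Ri (𝒥 : Set (BigMat n)) (i : Fin N) :
    (activeIndices 𝒥 (Finset.univ.erase i) (diagTerm i)).card ≤ Ri 𝒥 i := by
  unfold Ri
  rw [← ncard_coe_finset]
  refine ncard_le_ncard (fun k hk => ?_) (toFinite _)
  obtain ⟨hki, A, hA, X, hX, hne⟩ := (Set.Finite.mem_toFinset _).1 hk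
  rcases (Finset.ne_of_mem_erase hki).lt_or_gt with h | h
  · rw [← matBlt_mulVec i k A hX] at hne
    exact Or.inl ⟨h, active_of_mulVec_ne_zero hA hne⟩
  · rw [← matBgt_mulVec i k A hX] at hne
    exact Or.inr ⟨h, active_of_mulVec_ne_zero hA hne⟩

/-- The gain from `X_kj` to `X_ij`. -/
def Gains.left (g : Gains N) (i j k : Fin N) : ℝ := if k = j then g.η2 i j else g.γj i j k

/-- The gain from `X_ik` to `X_ij`. -/
def Gains.right (g : Gains N) (i j k : Fin N) : ℝ := if k = i then g.η1 i j else g.γi i j k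

variable {g : Gains N} {𝒥 : Set (BigMat n)}

/-- The position of `k` relative to `j` decides which block is stored: `X_kj`, the diagonal `X_jj`
(channel `G²`), or `X_jk`. -/
theorem Gains.AreBounds.exists_channelGain_left (hg : g.AreBounds 𝒥) {i j k : Fin N} (hij : i < j)
    (hk : k ≠ i) :
    ∃ M, 0 ≤ M ∧ ChannelGain 𝒥 (offDyn i j) (leftTerm i j k) (energy k j) (g.left i j k) M := by
  unfold Gains.left
  rcases lt_trichotomy k j with h | rfl | h
  · rw [if_neg h.ne]
    exact (hg.hγj_lt i j k hij hk h).exists_channelGain (continuous_offDyn i j)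
      (continuous_matHjlt i j k) (continuous_vecBlock k j)
      (fun A X _ => matHjlt_mulVec i j k A X) (fun X _ => energy_of_ne h.ne X)
  · rw [if_pos rfl]
    exact (hg.hη2 i k hij).exists_channelGain (continuous_offDyn i k) (continuous_matG2 i k)
      (continuous_halfBlock k) (fun A X hX => matG2_mulVec i k A hX) (fun X _ => energy_self k X)
  · rw [if_neg h.ne']
    exact (hg.hγj_gt i j k hij h).exists_channelGain (continuous_offDyn i j)
      (continuous_matHjgt i j k) (continuous_vecBlock j k)
      (fun A X hX => matHjgt_mulVec i j k A hX)
      (fun X hX => (hX.energy_comm k j).trans (energy_of_ne h.ne X))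

theorem Gains.AreBounds.exists_channelGain_right (hg : g.AreBounds 𝒥) {i j k : Fin N} (hij : i < j)
    (hk : k ≠ j) :
    ∃ M, 0 ≤ M ∧ ChannelGain 𝒥 (offDyn i j) (rightTerm i j k) (energy i k) (g.right i j k) M := by
  unfold Gains.right
  rcases lt_trichotomy k i with h | rfl | h
  · rw [if_neg h.ne]
    exact (hg.hγi_lt i j k hij h).exists_channelGain (continuous_offDyn i j)
      (continuous_matHilt i j k) (continuous_vecBlock k i)
      (fun A X hX => matHilt_mulVec i j k A hX)
      (fun X hX => (hX.energy_comm i k).trans (energy_of_ne h.ne X))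
  · rw [if_pos rfl]
    exact (hg.hη1 k j hij).exists_channelGain (continuous_offDyn k j) (continuous_matG1 k j)
      (continuous_halfBlock k) (fun A X hX => matG1_mulVec k j A hX) (fun X _ => energy_self k X)
  · rw [if_neg h.ne']
    exact (hg.hγi_gt i j k hij hk h).exists_channelGain (continuous_offDyn i j)
      (continuous_matHigt i j k) (continuous_vecBlock i k)
      (fun A X _ => matHigt_mulVec i j k A X) (fun X _ => energy_of_ne h.ne X)

theorem Gains.AreBounds.exists_channelGain_diag (hg : g.AreBounds 𝒥) {i k : Fin N} (hk : k ≠ i) :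
    ∃ M, 0 ≤ M ∧ ChannelGain 𝒥 (diagDyn i) (diagTerm i k) (energy i k) (g.δ i k) M := by
  rcases hk.lt_or_gt with h | h
  · exact (hg.hδ_lt i k h).exists_channelGain (continuous_diagDyn i)
      (continuous_matBlt i k) (continuous_vecBlock k i) (fun A X hX => matBlt_mulVec i k A hX)
      (fun X hX => (hX.energy_comm i k).trans (energy_of_ne h.ne X))
  · exact (hg.hδ_gt i k h).exists_channelGain (continuous_diagDyn i)
      (continuous_matBgt i k) (continuous_vecBlock i k) (fun A X hX => matBgt_mulVec i k A hX)
      (fun X _ => energy_of_ne h.ne X)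

theorem energy_zero (k l : Fin N) : energy (n := n) k l 0 = 0 := by
  unfold energy halfBlock vecBlock subBlock
  simp

/-- `X` is a continuous skew-symmetric signal with `X' = A X + X Aᵀ` on `[0, ∞)`. -/
structure IsLyapunovFlow (A : ℝ → BigMat n) (X : ℝ → Idx n → Idx n → ℝ) : Prop where
  continuous : Continuous X
  isSkew : ∀ t, IsSkew (X t)
  hasDeriv : ∀ t, 0 ≤ t → ∀ a b, a < b → HasDerivWithinAt (fun t => X t a b)
    (∑ c, (A t a c * X t c b + X t a c * A t b c)) (Ici 0) t

theorem hasDerivWithinAt_toLp {ι : Type*} [Fintype ι] {y : ℝ → ι → ℝ} {y' : ι → ℝ} {s : Set ℝ}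
    {t : ℝ} (h : ∀ p, HasDerivWithinAt (fun t => y t p) (y' p) s t) :
    HasDerivWithinAt (fun t => (WithLp.toLp 2 (y t) : EuclideanSpace ℝ ι)) (WithLp.toLp 2 y') s t :=
  ((PiLp.continuousLinearEquiv 2 ℝ fun _ : ι => ℝ).symm.hasFDerivAt).comp_hasDerivWithinAt t
    (hasDerivWithinAt_pi.2 h)

theorem Gains.AreBounds.exists_offDiag_bound (hg : g.AreBounds 𝒥) {i j : Fin N} (hij : i < j) :
    ∃ M, 0 ≤ M ∧ ∀ A : ℝ → BigMat n, Continuous A → (∀ t, A t ∈ 𝒥) →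
      ∀ X : ℝ → Idx n → Idx n → ℝ, IsLyapunovFlow A X → ∀ τ : ℝ, 0 ≤ τ →
      ∫ t in (0 : ℝ)..τ, energy i j (X t) ≤ Rij 𝒥 i j *
        (∑ k ∈ Finset.univ.erase i, g.left i j k ^ 2 * (∫ t in (0 : ℝ)..τ, energy k j (X t)) +
          ∑ k ∈ Finset.univ.erase j, g.right i j k ^ 2 * (∫ t in (0 : ℝ)..τ, energy i k (X t))) +
        M * energy i j (X 0) := by
  obtain ⟨M, hM, h⟩ := exists_multichannel_bound (𝒥 := 𝒥)
    -- A disjoint sum, because the same `k` may occur both through `A_ik X_kj` and through `X_ik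
    -- A_jkᵀ`.
    (P := (Finset.univ.erase i).disjSum (Finset.univ.erase j))
    ⟨Sum.inl j, by simp [hij.ne']⟩ (continuous_offDyn (n := n) i j)
    (F := Sum.elim (leftTerm i j) (rightTerm i j))
    (by rintro (k | k) -
        exacts [continuous_leftTerm i j k, continuous_rightTerm i j k])
    (Z := Sum.elim (fun k => energy k j) (fun k => energy i k))
    (by rintro (k | k) - <;> exact energy_zero _ _)
    (by rintro (k | k) - X <;> exact energy_nonneg _ _ _)
    (γ := Sum.elim (g.left i j) (g.right i j))
    (by rintro (k | k) hk
        · exact hg.exists_channelGain_left hij (by simpa using hk)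
        · exact hg.exists_channelGain_right hij (by simpa using hk))
    (R := Rij 𝒥 i j)
    (s := (activeIndices 𝒥 (Finset.univ.erase i) (leftTerm i j)).disjSum
      (activeIndices 𝒥 (Finset.univ.erase j) (rightTerm i j)))
    (Finset.disjSum_mono (activeIndices_subset _ _ _) (activeIndices_subset _ _ _))
    (by rw [Finset.card_disjSum]; exact card_activeIndices_add_le_Rij 𝒥 i j)
    (by rintro (k | k) hk hks A hA X hX
        · exact eq_zero_of_notMem_activeIndices (F := leftTerm i j) (Finset.inl_mem_disjSum.1 hk)
            (fun h => hks (Finset.inl_mem_disjSum.2 h)) hA hX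
        · exact eq_zero_of_notMem_activeIndices (F := rightTerm i j) (Finset.inr_mem_disjSum.1 hk)
            (fun h => hks (Finset.inr_mem_disjSum.2 h)) hA hX)
  refine ⟨M, hM, fun A hA hA𝒥 X hX τ hτ => ?_⟩
  have hnorm : ∀ t, ‖(WithLp.toLp 2 (vecBlock i j (X t)) :
      EuclideanSpace ℝ (Fin (n i) × Fin (n j)))‖ ^ 2 = energy i j (X t) := fun t => by
    rw [EuclideanSpace.norm_sq_eq, energy_of_ne hij.ne]
    simp
  have key := h A hA hA𝒥 X hX.continuous hX.isSkew τ hτ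
    (fun t => WithLp.toLp 2 (vecBlock i j (X t))) (fun t ht => by
      refine hasDerivWithinAt_toLp fun p => ?_
      refine (hX.hasDeriv t ht.1 (toLex ⟨i, p.1⟩) (toLex ⟨j, p.2⟩)
        (Sigma.Lex.left _ _ hij)).congr_deriv ?_
      rw [sum_leftTerm_add_rightTerm, Finset.sum_disjSum, offDyn_mulVec,
        ← Finset.add_sum_erase _ _ (Finset.mem_univ i),
        ← Finset.add_sum_erase (a := j) _ (fun k => rightTerm i j k (A t) (X t) p)
          (Finset.mem_univ j)]
      simp only [Pi.add_apply, Finset.sum_apply, Sum.elim_inl, Sum.elim_inr]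
      ring)
  simp only [hnorm, Finset.sum_disjSum, Sum.elim_inl, Sum.elim_inr] at key
  exact key

theorem Gains.AreBounds.exists_diag_bound (hN : 2 ≤ N) (hg : g.AreBounds 𝒥) (i : Fin N) :
    ∃ M, 0 ≤ M ∧ ∀ A : ℝ → BigMat n, Continuous A → (∀ t, A t ∈ 𝒥) →
      ∀ X : ℝ → Idx n → Idx n → ℝ, IsLyapunovFlow A X → ∀ τ : ℝ, 0 ≤ τ →
      ∫ t in (0 : ℝ)..τ, energy i i (X t) ≤ Ri 𝒥 i *
        ∑ k ∈ Finset.univ.erase i, g.δ i k ^ 2 * (∫ t in (0 : ℝ)..τ, energy i k (X t)) +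
        M * energy i i (X 0) := by
  -- With `N ≥ 2` there is at least one channel into `X_ii`, and its gain bound supplies the
  -- stability of `A_ii^[2]` even if all `B_ik` vanish.
  have : Nontrivial (Fin N) := Fin.nontrivial_iff_two_le.2 hN
  obtain ⟨k₀, hk₀⟩ := exists_ne i
  obtain ⟨M, hM, h⟩ := exists_multichannel_bound (𝒥 := 𝒥) (P := Finset.univ.erase i)
    ⟨k₀, by simp [hk₀]⟩ (continuous_diagDyn (n := n) i) (F := diagTerm i)
    (fun k _ => continuous_diagTerm i k) (Z := fun k => energy i k)
    (fun k _ => energy_zero _ _) (fun k _ X => energy_nonneg _ _ _) (γ := g.δ i)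
    (fun k hk => hg.exists_channelGain_diag (Finset.ne_of_mem_erase hk)) (R := Ri 𝒥 i)
    (s := activeIndices 𝒥 (Finset.univ.erase i) (diagTerm i))
    (activeIndices_subset _ _ _) (card_activeIndices_le_Ri 𝒥 i)
    (fun k hk hks A hA X hX => eq_zero_of_notMem_activeIndices hk hks hA hX)
  refine ⟨M, hM, fun A hA hA𝒥 X hX τ hτ => ?_⟩
  have hnorm : ∀ t, ‖(WithLp.toLp 2 (halfBlock i (X t)) :
      EuclideanSpace ℝ (OrdPair (Fin (n i))))‖ ^ 2 = energy i i (X t) := fun t => by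
    rw [EuclideanSpace.norm_sq_eq, energy_self]
    simp
  have key := h A hA hA𝒥 X hX.continuous hX.isSkew τ hτ
    (fun t => WithLp.toLp 2 (halfBlock i (X t))) (fun t ht => by
      refine hasDerivWithinAt_toLp fun p => ?_
      refine (hX.hasDeriv t ht.1 (toLex ⟨i, p.1.1⟩) (toLex ⟨i, p.1.2⟩)
        (Sigma.Lex.right _ _ p.2)).congr_deriv ?_
      rw [sum_leftTerm_add_rightTerm i i _ _ p.1, diagDyn_mulVec i _ (hX.isSkew t),
        ← Finset.sum_add_distrib, ← Finset.add_sum_erase _ _ (Finset.mem_univ i)]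
      simp only [Pi.add_apply, Finset.sum_apply]
      rfl)
  simp only [hnorm] at key
  exact key

end Subsystems

/-! ### The interconnection -/

section GainMatrices

variable {N : ℕ} {n : Fin N → ℕ} (𝒥 : Set (BigMat n)) (g : Gains N)

theorem gainΓ_nonneg (p q : OrdPair (Fin N)) : 0 ≤ gainΓ 𝒥 g p q := by
  simp only [gainΓ, Matrix.of_apply]
  split_ifs <;> positivity

theorem gainΔ_nonneg (i : Fin N) (q : OrdPair (Fin N)) : 0 ≤ gainΔ 𝒥 g i q := by
  simp only [gainΔ, Matrix.of_apply]
  split_ifs <;> positivity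

theorem gainΥ_nonneg (p : OrdPair (Fin N)) (k : Fin N) : 0 ≤ gainΥ 𝒥 g p k := by
  simp only [gainΥ, Matrix.of_apply]
  split_ifs <;> positivity

theorem gainΔ_mulVec {e : Fin N → Fin N → ℝ} (he : ∀ k l, e k l = e l k) (i : Fin N) :
    (gainΔ 𝒥 g *ᵥ fun q => e q.1.1 q.1.2) i =
      Ri 𝒥 i * ∑ k ∈ Finset.univ.erase i, g.δ i k ^ 2 * e i k := by
  have h1 : (gainΔ 𝒥 g *ᵥ fun q => e q.1.1 q.1.2) i = ∑ l, ∑ m, if l < m then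
      (if l = i then (Ri 𝒥 i : ℝ) * g.δ i m ^ 2 else if m = i then (Ri 𝒥 i : ℝ) * g.δ i l ^ 2
        else 0) * e l m else 0 :=
    sum_ordPair fun l m => (if l = i then (Ri 𝒥 i : ℝ) * g.δ i m ^ 2 else
      if m = i then (Ri 𝒥 i : ℝ) * g.δ i l ^ 2 else 0) * e l m
  have h2 : ∀ l m : Fin N, (if l < m then
      (if l = i then (Ri 𝒥 i : ℝ) * g.δ i m ^ 2 else if m = i then (Ri 𝒥 i : ℝ) * g.δ i l ^ 2
        else 0) * e l m else 0) =
      (if l = i then if l < m then (Ri 𝒥 i : ℝ) * g.δ i m ^ 2 * e i m else 0 else 0) +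
      (if m = i then if l < m then (Ri 𝒥 i : ℝ) * g.δ i l ^ 2 * e i l else 0 else 0) := by
    intro l m
    by_cases h : l < m
    · by_cases h1 : l = i
      · subst h1; simp [h, h.ne']
      · by_cases h2 : m = i
        · subst h2; simp [h, h.ne, he l m]
        · simp [h1, h2]
    · simp [h]
  rw [h1]
  simp only [h2, Finset.sum_add_distrib, Finset.sum_ite_irrel, Finset.sum_const_zero,
    Finset.sum_ite_eq', Finset.mem_univ, if_true]
  rw [← Finset.sum_add_distrib, Finset.mul_sum, ← Finset.add_sum_erase _ _ (Finset.mem_univ i)]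
  simp only [lt_irrefl, if_false, add_zero, zero_add]
  refine Finset.sum_congr rfl fun k hk => ?_
  rcases (Finset.ne_of_mem_erase hk).lt_or_gt with h | h <;> simp [h, h.not_gt] <;> ring

theorem gainΥ_mulVec (p : OrdPair (Fin N)) (ξ : Fin N → ℝ) :
    (gainΥ 𝒥 g *ᵥ ξ) p = Rij 𝒥 p.1.1 p.1.2 *
      (g.η1 p.1.1 p.1.2 ^ 2 * ξ p.1.1 + g.η2 p.1.1 p.1.2 ^ 2 * ξ p.1.2) := by
  have h : ∀ k, gainΥ 𝒥 g p k * ξ k =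
      (if p.1.1 = k then (Rij 𝒥 p.1.1 p.1.2 : ℝ) * g.η1 p.1.1 p.1.2 ^ 2 * ξ k else 0) +
      (if p.1.2 = k then (Rij 𝒥 p.1.1 p.1.2 : ℝ) * g.η2 p.1.1 p.1.2 ^ 2 * ξ k else 0) := by
    intro k
    simp only [gainΥ, Matrix.of_apply]
    by_cases h1 : p.1.1 = k
    · simp [h1, (h1 ▸ p.2.ne' : p.1.2 ≠ k)]
    · simp [h1]
  simp only [Matrix.mulVec, dotProduct, h, Finset.sum_add_distrib, Finset.sum_ite_eq,
    Finset.mem_univ, if_true]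
  ring

/-- The gain matrices are the block-wise estimate rewritten: a pair meeting `{i, j}` in one index
corresponds to one `k ∉ {i, j}` in the left or right sum, and the two remaining indices `k = j`, `k
= i` give `Υ`. -/
theorem gainΓ_mulVec_add_gainΥ_mulVec {e : Fin N → Fin N → ℝ} (he : ∀ k l, e k l = e l k)
    (p : OrdPair (Fin N)) :
    (gainΓ 𝒥 g *ᵥ fun q => e q.1.1 q.1.2) p + (gainΥ 𝒥 g *ᵥ fun k => e k k) p =
      Rij 𝒥 p.1.1 p.1.2 *
        (∑ k ∈ Finset.univ.erase p.1.1, g.left p.1.1 p.1.2 k ^ 2 * e k p.1.2 +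
          ∑ k ∈ Finset.univ.erase p.1.2, g.right p.1.1 p.1.2 k ^ 2 * e p.1.1 k) := by
  rw [gainΥ_mulVec]
  obtain ⟨⟨i, j⟩, hij⟩ := p
  simp only at hij ⊢
  set R : ℝ := ((Rij 𝒥 i j : ℕ) : ℝ)
  have h1 : (gainΓ 𝒥 g *ᵥ fun q => e q.1.1 q.1.2) ⟨(i, j), hij⟩ = ∑ l, ∑ m, if l < m then
      (if (i, j) = (l, m) then 0 else if l = i then R * g.γi i j m ^ 2
        else if m = i then R * g.γi i j l ^ 2 else if l = j then R * g.γj i j m ^ 2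
        else if m = j then R * g.γj i j l ^ 2 else 0) * e l m else 0 := by
    rw [← sum_ordPair]
    refine Finset.sum_congr rfl fun q _ => ?_
    simp only [gainΓ, Matrix.of_apply, Subtype.ext_iff]
    rfl
  -- The four ways in which `(l, m)` can share an index with `(i, j)`. The pair `(i, j)` itself
  -- would fall under both `l = i` and `m = j`, so it is removed from these two.
  have h2 : ∀ l m : Fin N, (if l < m then
      (if (i, j) = (l, m) then 0 else if l = i then R * g.γi i j m ^ 2
        else if m = i then R * g.γi i j l ^ 2 else if l = j then R * g.γj i j m ^ 2
        else if m = j then R * g.γj i j l ^ 2 else 0) * e l m else 0) =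
      (if l = i then if l < m then if m = j then 0 else R * (g.γi i j m ^ 2 * e i m) else 0
        else 0) +
      (if m = i then if l < m then R * (g.γi i j l ^ 2 * e i l) else 0 else 0) +
      (if l = j then if l < m then R * (g.γj i j m ^ 2 * e m j) else 0 else 0) +
      (if m = j then if l < m then if l = i then 0 else R * (g.γj i j l ^ 2 * e l j) else 0
        else 0) := by
    intro l m
    simp only [Prod.mk.injEq]
    by_cases h : l < m
    · by_cases a1 : l = i
      · subst a1
        by_cases a2 : m = j
        · subst a2; simp [h.ne, h.ne']
        · simp [h, h.ne', hij.ne, a2, Ne.symm a2, mul_assoc]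
      · by_cases a2 : m = i
        · subst a2
          simp [h, a1, Ne.symm a1, hij.ne, (h.trans hij).ne, he l m, mul_assoc]
        · by_cases a3 : l = j
          · subst a3
            simp [h, a1, a2, Ne.symm a1, h.ne', he l m, mul_assoc]
          · by_cases a4 : m = j
            · subst a4; simp [h, a1, a2, a3, Ne.symm a1, mul_assoc]
            · simp [h, a1, a2, a3, a4, Ne.symm a1]
    · simp [h]
  rw [h1]
  simp only [h2, Finset.sum_add_distrib, Finset.sum_ite_irrel, Finset.sum_const_zero,
    Finset.sum_ite_eq', Finset.mem_univ, if_true]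
  have hl : R * ∑ k ∈ Finset.univ.erase i, g.left i j k ^ 2 * e k j = R * (g.η2 i j ^ 2 * e j j) +
      ∑ k, ((if j < k then R * (g.γj i j k ^ 2 * e k j) else 0) +
        if k < j then if k = i then 0 else R * (g.γj i j k ^ 2 * e k j) else 0) := by
    rw [← Finset.add_sum_erase _ _ (Finset.mem_univ i),
      ← Finset.add_sum_erase (Finset.univ.erase i) _
        (Finset.mem_erase.2 ⟨hij.ne', Finset.mem_univ j⟩),
      ← Finset.add_sum_erase (Finset.univ.erase i) _
        (Finset.mem_erase.2 ⟨hij.ne', Finset.mem_univ j⟩)]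
    simp only [Gains.left, if_true, lt_irrefl, hij, hij.not_gt, if_false, zero_add, add_zero,
      mul_add, Finset.mul_sum]
    congr 1
    refine Finset.sum_congr rfl fun k hk => ?_
    have hkj := Finset.ne_of_mem_erase hk
    have hki := Finset.ne_of_mem_erase (Finset.mem_of_mem_erase hk)
    rcases hkj.lt_or_gt with h | h <;> simp [h, h.not_gt, hkj, hki]
  have hr : R * ∑ k ∈ Finset.univ.erase j, g.right i j k ^ 2 * e i k =
      R * (g.η1 i j ^ 2 * e i i) +
      ∑ k, ((if i < k then if k = j then 0 else R * (g.γi i j k ^ 2 * e i k) else 0) +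
        if k < i then R * (g.γi i j k ^ 2 * e i k) else 0) := by
    rw [← Finset.add_sum_erase _ _ (Finset.mem_univ j),
      ← Finset.add_sum_erase (Finset.univ.erase j) _
        (Finset.mem_erase.2 ⟨hij.ne, Finset.mem_univ i⟩),
      ← Finset.add_sum_erase (Finset.univ.erase j) _
        (Finset.mem_erase.2 ⟨hij.ne, Finset.mem_univ i⟩)]
    simp only [Gains.right, if_true, lt_irrefl, hij, hij.not_gt, if_false, zero_add, add_zero,
      mul_add, Finset.mul_sum]
    congr 1
    refine Finset.sum_congr rfl fun k hk => ?_
    have hki := Finset.ne_of_mem_erase hk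
    have hkj := Finset.ne_of_mem_erase (Finset.mem_of_mem_erase hk)
    rcases hki.lt_or_gt with h | h <;> simp [h, h.not_gt, hkj, hki]
  rw [mul_add R (∑ k ∈ Finset.univ.erase i, _), hl, hr, Finset.sum_add_distrib,
    Finset.sum_add_distrib]
  ring

end GainMatrices

/-! ### The small-gain estimate for all blocks together. -/

section Interconnection

variable {N : ℕ} {n : Fin N → ℕ} {𝒥 : Set (BigMat n)} {g : Gains N}

/-- The offsets in the gain definition are chosen before the coefficients and solutions, so `C` is
independent of `A`, `X` and `τ`. -/
theorem Gains.AreBounds.exists_energy_bound (hN : 2 ≤ N) (hg : g.AreBounds 𝒥)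
    (hρ : specRad (gainΥ 𝒥 g * gainΔ 𝒥 g + gainΓ 𝒥 g) < 1) :
    ∃ C, 0 ≤ C ∧ ∀ A : ℝ → BigMat n, Continuous A → (∀ t, A t ∈ 𝒥) →
      ∀ X : ℝ → Idx n → Idx n → ℝ, IsLyapunovFlow A X → ∀ τ : ℝ, 0 ≤ τ →
      ∀ b, (∀ k l, energy k l (X 0) ≤ b) →
      ∀ k l, k ≤ l → ∫ t in (0 : ℝ)..τ, energy k l (X t) ≤ C * b := by
  have hoff := fun p : OrdPair (Fin N) => hg.exists_offDiag_bound p.2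
  have hdiag := fun i : Fin N => hg.exists_diag_bound hN i
  choose M hM hMoff using hoff
  choose M' hM' hMdiag using hdiag
  have hM0 : 0 ≤ ∑ p, M p := Finset.sum_nonneg fun p _ => hM p
  have hM0' : 0 ≤ ∑ i, M' i := Finset.sum_nonneg fun i _ => hM' i
  obtain ⟨m, hm, hMm, hMm'⟩ : ∃ m : ℝ, 0 ≤ m ∧ (∀ p, M p ≤ m) ∧ ∀ i, M' i ≤ m :=
    ⟨∑ p, M p + ∑ i, M' i, add_nonneg hM0 hM0', fun p =>
      (Finset.single_le_sum (fun p _ => hM p) (Finset.mem_univ p)).trans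
        (le_add_of_nonneg_right hM0'), fun i =>
      (Finset.single_le_sum (fun i _ => hM' i) (Finset.mem_univ i)).trans
        (le_add_of_nonneg_left hM0)⟩
  obtain ⟨C, hC, hsg⟩ := exists_bound_of_le_mulVec_pair (gainΓ_nonneg 𝒥 g) (gainΥ_nonneg 𝒥 g)
    (gainΔ_nonneg 𝒥 g) hρ
  refine ⟨C * m, by positivity, fun A hA hA𝒥 X hX τ hτ b hb => ?_⟩
  have hb0 : 0 ≤ b := (energy_nonneg _ _ _).trans (hb ⟨0, by lia⟩ ⟨0, by lia⟩)
  have hsymm : ∀ k l, (∫ t in (0 : ℝ)..τ, energy k l (X t)) = ∫ t in (0 : ℝ)..τ, energy l k (X t) :=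
    fun k l => by simp only [fun t => (hX.isSkew t).energy_comm k l]
  have key := hsg (fun p => ∫ t in (0 : ℝ)..τ, energy p.1.1 p.1.2 (X t))
    (fun k => ∫ t in (0 : ℝ)..τ, energy k k (X t)) (m * b)
    (fun p => intervalIntegral.integral_nonneg hτ fun t _ => energy_nonneg _ _ _)
    (by positivity)
    (fun p => by
      rw [gainΓ_mulVec_add_gainΥ_mulVec 𝒥 g hsymm]
      exact (hMoff p A hA hA𝒥 X hX τ hτ).trans (add_le_add le_rfl
        (mul_le_mul (hMm p) (hb _ _) (energy_nonneg _ _ _) hm)))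
    (fun i => by
      rw [gainΔ_mulVec 𝒥 g hsymm]
      exact (hMdiag i A hA hA𝒥 X hX τ hτ).trans (add_le_add le_rfl
        (mul_le_mul (hMm' i) (hb i i) (energy_nonneg _ _ _) hm)))
  intro k l hkl
  rw [mul_assoc]
  rcases hkl.lt_or_eq with h | rfl
  · exact key.1 ⟨(k, l), h⟩
  · exact key.2 k

theorem sq_skew_le {ι : Type*} [Fintype ι] [LinearOrder ι] (y : EuclideanSpace ℝ (OrdPair ι))
    (a b : ι) : skew y.ofLp a b ^ 2 ≤ ‖y‖ ^ 2 := by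
  have h : ∀ p, y.ofLp p ^ 2 ≤ ‖y‖ ^ 2 := fun p => by
    have := PiLp.norm_apply_le y p
    rw [← sq_abs, ← Real.norm_eq_abs]
    gcongr
  unfold skew
  split_ifs
  · exact h _
  · rw [neg_sq]; exact h _
  · rw [zero_pow two_ne_zero]; positivity

theorem exists_energy_skew_le : ∃ c : ℝ, 0 ≤ c ∧ ∀ y : EuclideanSpace ℝ (OrdPair (Idx n)),
    ∀ k l, energy k l (skew y.ofLp) ≤ c * ‖y‖ ^ 2 := by
  have h : ∀ k l, ∃ c : ℝ, 0 ≤ c ∧ ∀ y : EuclideanSpace ℝ (OrdPair (Idx n)),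
      energy k l (skew y.ofLp) ≤ c * ‖y‖ ^ 2 := by
    intro k l
    unfold energy
    split_ifs
    · refine ⟨Fintype.card (OrdPair (Fin (n k))), by positivity, fun y => ?_⟩
      refine (Finset.sum_le_card_nsmul _ _ _ fun p _ => sq_skew_le y _ _).trans (le_of_eq ?_)
      simp
    · refine ⟨Fintype.card (Fin (n k) × Fin (n l)), by positivity, fun y => ?_⟩
      refine (Finset.sum_le_card_nsmul _ _ _ fun p _ => sq_skew_le y _ _).trans (le_of_eq ?_)
      simp
  choose c hc hcy using h
  refine ⟨∑ k, ∑ l, c k l, Finset.sum_nonneg fun k _ => Finset.sum_nonneg fun l _ => hc k l,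
    fun y k l => (hcy k l y).trans (mul_le_mul_of_nonneg_right ?_ (sq_nonneg _))⟩
  exact (Finset.single_le_sum (fun l _ => hc k l) (Finset.mem_univ l)).trans
    (Finset.single_le_sum (f := fun k => ∑ l, c k l)
      (fun k _ => Finset.sum_nonneg fun l _ => hc k l) (Finset.mem_univ k))

/-- In the lexicographic order a pair of coordinates lies either in a block with `k < l` or strictly
above the diagonal of a diagonal block, so every coordinate is stored in some energy. -/
theorem exists_sq_le_energy (p : OrdPair (Idx n)) : ∃ k l, k ≤ l ∧
    ∀ y : OrdPair (Idx n) → ℝ, y p ^ 2 ≤ energy k l (skew y) := by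
  obtain ⟨⟨⟨k, a⟩, ⟨l, b⟩⟩, h⟩ := p
  rcases Sigma.Lex.lt_def.1 h with hkl | ⟨hkl, hab⟩
  · have hkl : k < l := hkl
    refine ⟨k, l, hkl.le, fun y => ?_⟩
    rw [energy_of_ne hkl.ne]
    refine (congrArg (· ^ 2) (skew_apply y ⟨(toLex ⟨k, a⟩, toLex ⟨l, b⟩), h⟩).symm).le.trans ?_
    exact Finset.single_le_sum (f := fun p => vecBlock k l (skew y) p ^ 2)
      (fun p _ => sq_nonneg _) (Finset.mem_univ (a, b))
  · obtain rfl : k = l := hkl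
    refine ⟨k, k, le_rfl, fun y => ?_⟩
    rw [energy_self]
    refine (congrArg (· ^ 2) (skew_apply y ⟨(toLex ⟨k, a⟩, toLex ⟨k, b⟩), h⟩).symm).le.trans ?_
    exact Finset.single_le_sum (f := fun p => halfBlock k (skew y) p ^ 2)
      (fun p _ => sq_nonneg _) (Finset.mem_univ ⟨(a, b), hab⟩)

theorem Gains.AreBounds.exists_integral_sq_norm_le (hN : 2 ≤ N) (hg : g.AreBounds 𝒥)
    (hρ : specRad (gainΥ 𝒥 g * gainΔ 𝒥 g + gainΓ 𝒥 g) < 1) :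
    ∃ C, 0 ≤ C ∧ ∀ A : ℝ → BigMat n, ContinuousOn A (Ici 0) → (∀ t, 0 ≤ t → A t ∈ 𝒥) →
      ∀ y : ℝ → EuclideanSpace ℝ (OrdPair (Idx n)), (∀ t, 0 ≤ t → HasDerivWithinAt y
        (WithLp.toLp 2 (addCompound2 (A t) *ᵥ (y t).ofLp)) (Ici 0) t) → ∀ τ : ℝ, 0 ≤ τ →
      ∫ t in (0 : ℝ)..τ, ‖y t‖ ^ 2 ≤ C * ‖y 0‖ ^ 2 := by
  obtain ⟨C, hC, h⟩ := hg.exists_energy_bound hN hρ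
  obtain ⟨c, hc, hce⟩ := exists_energy_skew_le (n := n)
  choose K L hKL hsq using exists_sq_le_energy (n := n)
  refine ⟨Fintype.card (OrdPair (Idx n)) * (C * c), by positivity,
    fun A hA hA𝒥 y hy τ hτ => ?_⟩
  -- Signals given on `[0, ∞)` are extended to `ℝ` by their value at `0`, which keeps them
  -- continuous and in `𝒥`.
  have hmax : Continuous fun t : ℝ => max t 0 := by fun_prop
  have hyc : Continuous fun t => y (max t 0) :=
    ContinuousOn.comp_continuous (fun t ht => (hy t ht).continuousWithinAt) hmax
      fun t => le_max_right t 0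
  have hflow : IsLyapunovFlow (fun t => A (max t 0)) (fun t => skew (y (max t 0)).ofLp) := by
    refine ⟨continuous_skew.comp ((PiLp.continuous_ofLp 2 _).comp hyc), fun t => isSkew_skew _,
      fun t ht a b hab => ?_⟩
    have hd : HasDerivWithinAt (fun t => (y t).ofLp ⟨(a, b), hab⟩)
        ((addCompound2 (A t) *ᵥ (y t).ofLp) ⟨(a, b), hab⟩) (Ici 0) t :=
      (EuclideanSpace.proj (𝕜 := ℝ) (⟨(a, b), hab⟩ : OrdPair (Idx n))).hasFDerivAt
        |>.comp_hasDerivWithinAt t (hy t ht)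
    have hval := addCompound2_mulVec (A t) (isSkew_skew (y t).ofLp) ⟨(a, b), hab⟩
    simp only [skew_apply] at hval
    rw [show (fun q => (y t).ofLp q) = (y t).ofLp from rfl] at hval
    rw [hval] at hd
    simp only [max_eq_left ht]
    refine hd.congr_of_mem (fun s hs => ?_) ht
    rw [max_eq_left hs]
    exact skew_apply _ ⟨(a, b), hab⟩
  have hbound := h _ (hA.comp_continuous hmax fun t => le_max_right t 0)
    (fun t => hA𝒥 _ (le_max_right t 0)) _ hflow τ hτ (c * ‖y 0‖ ^ 2)
    (fun k l => by simpa using hce (y 0) k l)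
  have hint : ∀ k l, IntervalIntegrable (fun t => energy k l (skew (y (max t 0)).ofLp))
      volume 0 τ := fun k l =>
    ((continuous_energy k l).comp hflow.continuous).intervalIntegrable _ _
  calc ∫ t in (0 : ℝ)..τ, ‖y t‖ ^ 2 = ∫ t in (0 : ℝ)..τ, ‖y (max t 0)‖ ^ 2 := by
        refine intervalIntegral.integral_congr fun t ht => ?_
        rw [uIcc_of_le hτ] at ht
        simp only [max_eq_left ht.1]
    _ ≤ ∫ t in (0 : ℝ)..τ, ∑ p, energy (K p) (L p) (skew (y (max t 0)).ofLp) := by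
        refine intervalIntegral.integral_mono_on hτ ((hyc.norm.pow 2).intervalIntegrable _ _) ?_
          fun t _ => ?_
        · simpa only [Finset.sum_fn] using
            IntervalIntegrable.sum Finset.univ fun p _ => hint (K p) (L p)
        · rw [EuclideanSpace.norm_sq_eq]
          refine Finset.sum_le_sum fun p _ => ?_
          rw [Real.norm_eq_abs, sq_abs]
          exact hsq p _
    _ = ∑ p, ∫ t in (0 : ℝ)..τ, energy (K p) (L p) (skew (y (max t 0)).ofLp) :=
        intervalIntegral.integral_finsetSum fun p _ => hint (K p) (L p)
    _ ≤ ∑ _p : OrdPair (Idx n), C * (c * ‖y 0‖ ^ 2) :=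
        Finset.sum_le_sum fun p _ => hbound _ _ (hKL p)
    _ = _ := by
        rw [Finset.sum_const, Finset.card_univ, nsmul_eq_mul]
        ring

end Interconnection

/-! ### Continuity and boundedness of the compound of the Jacobian. -/

section Jacobian

variable {ι : Type*} [Fintype ι]

theorem continuous_matrix_of_clm : Continuous
    fun T : EuclideanSpace ℝ ι →L[ℝ] EuclideanSpace ℝ ι =>
      (Matrix.of fun a b => T (EuclideanSpace.basisFun ι ℝ b) a : Matrix ι ι ℝ) :=
  continuous_matrix fun a b => by
    simp only [Matrix.of_apply]
    fun_prop

/-- A bounded set of derivatives has compact closure in finite dimension, and the compound depends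
continuously on the derivative. -/
theorem exists_norm_addCompound2_jacobian_le [LinearOrder ι]
    {f : EuclideanSpace ℝ ι → EuclideanSpace ℝ ι} {D : Set (EuclideanSpace ℝ ι)}
    (hD : Bornology.IsBounded (fderiv ℝ f '' D)) :
    ∃ L, 0 ≤ L ∧ ∀ x ∈ D, ∀ v : EuclideanSpace ℝ (OrdPair ι),
      ‖(WithLp.toLp 2 (addCompound2 (jacobian f x) *ᵥ v.ofLp) : EuclideanSpace ℝ (OrdPair ι))‖ ≤
        L * ‖v‖ := by
  have : ProperSpace (EuclideanSpace ℝ ι →L[ℝ] EuclideanSpace ℝ ι) := FiniteDimensional.proper ℝ _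
  obtain ⟨L, hL⟩ := hD.isCompact_closure.exists_bound_of_continuousOn
    (continuous_toEuclideanCLM.comp
      (continuous_addCompound2.comp (continuous_matrix_of_clm (ι := ι)))).continuousOn
  refine ⟨max L 0, le_max_right _ _, fun x hx v => ?_⟩
  have h := hL _ (subset_closure (mem_image_of_mem _ hx))
  exact ContinuousLinearMap.le_of_opNorm_le
    (Matrix.toEuclideanCLM (𝕜 := ℝ) (addCompound2 (jacobian f x))) (h.trans (le_max_left _ _)) v

end Jacobian

end SmallGain

end

theorem mainTheorem1 {N : ℕ} (hN : 2 ≤ N) (n : Fin N → ℕ)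
    (f : EuclideanSpace ℝ (SmallGain.Idx n) → EuclideanSpace ℝ (SmallGain.Idx n))
    (hf : ContDiff ℝ 1 f)
    (D : Set (EuclideanSpace ℝ (SmallGain.Idx n)))
    (hD : Bornology.IsBounded (fderiv ℝ f '' D))
    (g : SmallGain.Gains N)
    (hg : g.AreBounds (SmallGain.jacobian f '' D))
    (hρ : SmallGain.specRad
      (SmallGain.gainΥ (SmallGain.jacobian f '' D) g * SmallGain.gainΔ (SmallGain.jacobian f '' D) g
        + SmallGain.gainΓ (SmallGain.jacobian f '' D) g) < 1) :
    SmallGain.IsTwoContractingOn f D := by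
  obtain ⟨C, hC, hCy⟩ := hg.exists_integral_sq_norm_le hN hρ
  obtain ⟨L, hL, hLv⟩ := SmallGain.exists_norm_addCompound2_jacobian_le hD
  obtain ⟨K, c, hK, hc, h⟩ := SmallGain.exists_exponential_bound
    (E := EuclideanSpace ℝ (SmallGain.OrdPair (SmallGain.Idx n))) hL hC
  refine ⟨K, c, hK, hc, fun x hx y hy => h y _ hy (fun t ht => hLv _ (hx t ht).2 _) ?_⟩
  intro s t hs hst
  have hJ : Continuous (SmallGain.jacobian f) :=
    SmallGain.continuous_matrix_of_clm.comp (hf.continuous_fderiv one_ne_zero)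
  have hxc : ContinuousOn (fun r => x (s + r)) (Ici 0) :=
    ContinuousOn.comp (t := Ici 0) (fun r hr => (hx r hr).1.continuousWithinAt)
      (by fun_prop) fun r hr => add_nonneg hs hr
  -- The coefficient shifted by `s` still takes values in `𝒥`, so the energy bound from time `0`
  -- holds from time `s` with the same `C`.
  have key := hCy (fun r => SmallGain.jacobian f (x (s + r))) (hJ.comp_continuousOn hxc)
    (fun r hr => mem_image_of_mem _ (hx _ (add_nonneg hs hr)).2) (fun r => y (s + r))
    (fun r hr => ((hy _ (add_nonneg hs hr)).scomp r
      ((hasDerivAt_id r).const_add s).hasDerivWithinAt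
      fun q hq => add_nonneg hs hq).congr_deriv (one_smul _ _)) (t - s) (sub_nonneg.2 hst)
  rw [intervalIntegral.integral_comp_add_left (fun r => ‖y r‖ ^ 2)] at key
  simpa using key
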